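/- **Setting.** Finite data (formulas, beliefs, operation names, actions, lists, instances) are finite binary trees; a language is a set of data; "polynomial time" refers to a structured programming language on such trees with a cost measure polynomially equivalent to Turing machine time, optionally with an oracle. For a class $\mathcal C$ of languages, $\mathrm{NP}^{\mathcal C}$ is the class of languages accepted in nondeterministic polynomial time with finitely many oracles from $\mathcal C$, and $\mathrm{co}\text{-}\mathcal C=\{L : L^c\in\mathcal C\}$. A decision problem with a set of admissible instances is *in* $\mathcal C$ if some $L\in\mathcal C$ answers correctly on all instances; it is *$\mathcal C$-hard* if every $L\in\mathcal C$ reduces to it by a polynomial-time many-one reduction into its instances. $\mathcal C$ is *closed under nondeterministic conjunctive reductions* if $L\in\mathcal C$ whenever, for finitely many $A_1,\dots,A_m\in\mathcal C$, the membership $x\in L$ is equivalent to the existence of a polynomial-size $w$ for which a polynomial-time function of $(x,w)$ does not reject and outputs a list of queries "$y\in A_j$?" that all have answer yes (e.g. $\mathrm{NP}$, $\Sigma_i^p$ with $i\ge1$, $\mathrm{PSPACE}$, $\mathrm{EXPTIME}$). **Contexts.** A *kind of context* consists of a logic $(KB,Cn,ACC)$ with finite knowledge bases and finite belief sets, $ACC(kb)\subseteq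 Cn$ for $kb\in KB$; a set $OP$ of operation names with a management function $mng(H,kb)\in KB$, for finite sets $H$ of operational statements $o(s)$ ($o\in OP$, $s$ an element of some knowledge base) and $kb\in KB$; a set $act$ of actions with an update function $\mathcal U(kb,\Pi)$, a finite non-empty subset of $KB$ for $kb\in KB$ and finite $\Pi\subseteq act$; and a timed triggering function $tr[T](kb)\subseteq H$, for $T\in\mathbb N$ and $H$ the finite set of heads of the context's bridge rules. Fix a finite library $\mathcal L$ of kinds for which $mng$, $\mathcal U$ and $tr$ are polynomial-time computable (also as functions of $H$ and of $T$ in unary), finite sets being presented by lists. **Systems.** A system $M$ consists of $\ell$ contexts $C_1,\dots,C_\ell$; each has a kind in $\mathcal L$, an initial $kb_i[0]\in KB_i$, an initial belief set $S_i[0]\in Cn_i$, and finitely many ground bridge rules $o(s)\leftarrow (c_1{:}p_1),\dots,(c_h{:}p_h),not\,(c_{h+1}{:}p_{h+1}),\dots,not\,(c_m{:}p_m)$; there are no bridge-rule patterns. The set $\mathit{app}_i(\vec S[T])$ consists of the heads of the rules of $C_i$ that are triggered at some $T'\le T$ (i.e. $hd(\rho)\in tr_i[T'](kb_i[T'])$)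 and whose body holds in $\vec S[T]$. Under a finite sequence $\Pi[1],\dots,\Pi[t]$ of action vectors, a *run* of length $t'\le t$ starts from the initial data and satisfies, for all $i$ and $T<t'$, $kb_i[T+1]=mng_i(\mathit{app}_i(\vec S[T]),kb')$ for some $kb'\in\mathcal U_i(kb_i[T],\Pi_i[T+1])$ and $S_i[T+1]\in ACC_i(mng_i(\mathit{app}_i(\vec S[T+1]),kb_i[T+1]))$. A *timed equilibrium* at time $t'\geq1$ is the belief state $\vec S[t']$ of a run of length $t'$. **Problems.** Given $M$, $\Pi[1],\dots,\Pi[t]$, a context $C_i$ and a belief $p$: $Q^\exists$ (resp. $Q^\forall$) asks whether $p\in S_i[t']$ for some (resp. for all) $t'\le t$ and timed equilibria $\vec S[t']$ at time $t'$. $Q^\exists_N,Q^\forall_N$, $N\in\mathbb N\cup\{\infty\}$, are their restrictions to $t\le N$. The *context problem* of a kind: given a finite set $H$ of operational statements (the heads applicable in a projected belief state), $kb\in KB$, a finite set $R$ of relevant beliefs and $P\subseteq R$ (the projected belief set), decide whether some $S\in ACC(mng(H,kb))$ satisfies $S\cap R=P$. *The system context complexity of $\mathcal L$ is in $\mathcal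 C$* if the context problem of every kind in $\mathcal L$ is in $\mathcal C$; it is *$\mathcal C$-hard* if the disjoint union of the context problems is. **Theorem.** Let $\mathcal L$ be as above, $N\in\mathbb N\cup\{\infty\}$, and let $\mathcal C$ be a class of languages. 1. (Membership.) Suppose that $N<\infty$, or that in all runs of systems over $\mathcal L$ the sizes of the knowledge bases are bounded by a fixed polynomial in the size of the instance. If the system context complexity is in $\mathcal C$, then $Q^\exists_N$ is in $\mathrm{NP}^{\mathcal C}$ and $Q^\forall_N$ is in $\mathrm{co}\text{-}\mathrm{NP}^{\mathcal C}$; if moreover $\mathcal C$ is closed under nondeterministic conjunctive reductions, then $Q^\exists_N$ is in $\mathcal C$ and $Q^\forall_N$ is in $\mathrm{co}\text{-}\mathcal C$. 2. (Hardness.) Let $N\ge1$, and suppose that for each kind in $\mathcal L$ some action leaves every knowledge base unchanged ($\mathcal U(kb,\Pi)=\{kb\}$) and that $mng(\emptyset,kb)=kb$. If the system context complexity of $\mathcal L$ is $\mathcal C$-hard, then for systems composed of contexts of kinds in $\mathcal L$ and of plain fact bases, $Q^\exists_N$ is $\mathcal C$-hard and $Q^\forall_N$ is $\mathrm{co}\text{-}\mathcal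 C$-hard. (A plain fact base has $ACC(kb)=\{kb\}$; updates and management store the received facts, and all its rules are triggered.) -/

import Mathlib

namespace TMCS

/-! Finite data, and programs with a cost semantics. -/

/-- Finite data are binary trees; formulas, beliefs, operation names, actions, lists and all
problem instances are data. -/
inductive Data where
  | leaf : Data
  | node : Data → Data → Data
  deriving DecidableEq

namespace Data

/-- The number of nodes and leaves. -/
def size : Data → ℕ
  | leaf => 1
  | node a b => a.size + b.size + 1

def left : Data → Data
  | leaf => leaf
  | node a _ => a

def right : Data → Data
  | leaf => leaf
  | node _ b => b

/-- Lists are coded as right-nested trees. -/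
def ofList : List Data → Data
  | [] => leaf
  | a :: l => node a (ofList l)

/-- Every datum is the code of exactly one list. -/
def toList : Data → List Data
  | leaf => []
  | node a b => a :: b.toList

theorem toList_ofList (l : List Data) : (ofList l).toList = l := by
  induction l with
  | nil => rfl
  | cons a l ih => simp [ofList, toList, ih]

/-- The finite set that is listed by a datum (order and repetitions are irrelevant). -/
def toFinset (d : Data) : Finset Data := d.toList.toFinset

/-- Numbers are coded in unary. -/
def ofNat : ℕ → Data
  | 0 => leaf
  | n + 1 => node leaf (ofNat n)

end Data

/-- Structured programs on data, possibly with calls to an oracle. A program computes a partial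
function from data to data. -/
inductive Code where
  | leaf : Code
  | id : Code
  | left : Code
  | right : Code
  | pair : Code → Code → Code
  | comp : Code → Code → Code
  | cond : Code → Code → Code → Code
  | loop : Code → Code → Code
  | oracle : Code

/-- `Eval A c x y n`: with oracle `A`, the program `c` maps the input `x` to `y` at cost `n`.
Copying or reading a datum costs its size, so that polynomial cost is the same as polynomial time
on Turing machines (with the same oracle). The empty tree `leaf` is the truth value *false*, every
other datum is *true*. `loop c f` means: while `c` is true, apply `f`. -/
inductive Eval (A : Set Data) : Code → Data → Data → ℕ → Prop
  | leaf (x : Data) : Eval A .leaf x .leaf 1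
  | id (x : Data) : Eval A .id x x x.size
  | left (x : Data) : Eval A .left x x.left x.size
  | right (x : Data) : Eval A .right x x.right x.size
  | pair {f g : Code} {x y z : Data} {m n : ℕ} :
      Eval A f x y m → Eval A g x z n → Eval A (.pair f g) x (.node y z) (m + n + 1)
  | comp {f g : Code} {x y z : Data} {m n : ℕ} :
      Eval A g x y m → Eval A f y z n → Eval A (.comp f g) x z (m + n + 1)
  | condTrue {c f g : Code} {x y z : Data} {m n : ℕ} :
      Eval A c x y m → y ≠ .leaf → Eval A f x z n → Eval A (.cond c f g) x z (m + n + 1)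
  | condFalse {c f g : Code} {x z : Data} {m n : ℕ} :
      Eval A c x .leaf m → Eval A g x z n → Eval A (.cond c f g) x z (m + n + 1)
  | loopDone {c f : Code} {x : Data} {m : ℕ} :
      Eval A c x .leaf m → Eval A (.loop c f) x x (m + x.size)
  | loopStep {c f : Code} {x y x' z : Data} {m n k : ℕ} :
      Eval A c x y m → y ≠ .leaf → Eval A f x x' n → Eval A (.loop c f) x' z k →
        Eval A (.loop c f) x z (m + n + k + 1)
  | oracleTrue {x : Data} : x ∈ A → Eval A .oracle x (.node .leaf .leaf) (x.size + 2)
  | oracleFalse {x : Data} : x ∉ A → Eval A .oracle x .leaf (x.size + 2)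

/-- `f` is computable in polynomial time with oracle `A`. -/
def PolyTimeWith (A : Set Data) (f : Data → Data) : Prop :=
  ∃ (c : Code) (q : Polynomial ℕ), ∀ x, ∃ n ≤ q.eval x.size, Eval A c x (f x) n

/-- `f` is computable in polynomial time (without oracle). -/
def PolyTime (f : Data → Data) : Prop := PolyTimeWith ∅ f

/-! Complexity classes are sets of languages; a language is a set of data. -/

/-- `NP` with oracle `A`: a certificate of polynomial size is guessed and checked in polynomial
time with oracle `A`. -/
def NPOracle (A : Set Data) : Set (Set Data) :=
  {L | ∃ (g : Data → Data) (p : Polynomial ℕ), PolyTimeWith A g ∧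
    ∀ x, x ∈ L ↔ ∃ w, w.size ≤ p.eval x.size ∧ g (.node x w) ≠ .leaf}

/-- The join (disjoint union) of finitely many languages. -/
def join {m : ℕ} (A : Fin m → Set Data) : Set Data :=
  {x | ∃ (j : Fin m) (y : Data), x = .node (.ofNat j) y ∧ y ∈ A j}

/-- `NP` with finitely many oracles from the class `𝒞`. -/
def NPRel (𝒞 : Set (Set Data)) : Set (Set Data) :=
  {L | ∃ (m : ℕ) (A : Fin m → Set Data), (∀ j, A j ∈ 𝒞) ∧ L ∈ NPOracle (join A)}

/-- The class of complements. -/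
def co (𝒞 : Set (Set Data)) : Set (Set Data) := {L | Lᶜ ∈ 𝒞}

/-- Nondeterministic polynomial-time conjunctive reducibility of `L` to `A`: a certificate `w` of
polynomial size is guessed; from `x` and `w` a polynomial-time function either rejects, or produces
a list of queries; `x` is in `L` iff for some `w` it does not reject and all queries are in `A`. -/
def NPConjReducible (L A : Set Data) : Prop :=
  ∃ (f : Data → Data) (p : Polynomial ℕ), PolyTime f ∧
    ∀ x, x ∈ L ↔ ∃ w, w.size ≤ p.eval x.size ∧
      ∃ qs : List Data, f (.node x w) = .node .leaf (.ofList qs) ∧ ∀ q ∈ qs, q ∈ A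

/-- Closure under nondeterministic conjunctive reductions to finitely many members, as for
`NP`, the classes `Σᵢᵖ` with `i ≥ 1`, `PSPACE`, `EXPTIME`. -/
def NPConjClosed (𝒞 : Set (Set Data)) : Prop :=
  ∀ (m : ℕ) (A : Fin m → Set Data), (∀ j, A j ∈ 𝒞) →
    ∀ L, NPConjReducible L (join A) → L ∈ 𝒞

/-- A decision problem: its instances, and the instances with answer *yes*. -/
structure DecisionProblem where
  instances : Set Data
  yes : Set Data

/-- The problem is in the class `𝒞`: some language of `𝒞` gives the right answer on all
instances. -/
def DecisionProblem.MemClass (P : DecisionProblem) (𝒞 : Set (Set Data)) : Prop :=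
  ∃ L ∈ 𝒞, ∀ x ∈ P.instances, (x ∈ L ↔ x ∈ P.yes)

/-- The problem is hard for `𝒞` under polynomial-time many-one reductions. -/
def DecisionProblem.Hard (P : DecisionProblem) (𝒞 : Set (Set Data)) : Prop :=
  ∀ L ∈ 𝒞, ∃ f : Data → Data, PolyTime f ∧ ∀ x, f x ∈ P.instances ∧ (x ∈ L ↔ f x ∈ P.yes)

/-! Managed contexts with updates and triggering. -/

/-- An operational statement `o(s)`, as the pair `(o, s)`. -/
abbrev OpStmt := Data × Data

def OpStmt.enc (h : OpStmt) : Data := .node h.1 h.2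

/-- What a context consists of, apart from its knowledge base and its bridge rules: a logic
`(KB, Cn, ACC)` with finite knowledge bases and finite belief sets, operation names `OP` with a
management function `mng`, elementary actions `act` with a (nondeterministic, never empty) update
function `upd`, and a timed triggering function: `trig T H kb` is the set of triggered heads at time
`T`, where `H` is the set of heads of the bridge rules of the context. -/
structure ContextKind where
  KB : Set (Finset Data)
  Cn : Set (Finset Data)
  ACC : Finset Data → Set (Finset Data)
  ACC_subset : ∀ kb ∈ KB, ACC kb ⊆ Cn
  OP : Set Data
  mng : Finset OpStmt → Finset Data → Finset Data
  mng_mem : ∀ (H : Finset OpStmt), ∀ kb ∈ KB,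
    (∀ h ∈ H, h.1 ∈ OP ∧ ∃ kb' ∈ KB, h.2 ∈ kb') → mng H kb ∈ KB
  act : Set Data
  upd : Finset Data → Finset Data → Finset (Finset Data)
  upd_nonempty : ∀ kb ∈ KB, ∀ a : Finset Data, (a : Set Data) ⊆ act → (upd kb a).Nonempty
  upd_mem : ∀ kb ∈ KB, ∀ a : Finset Data, (a : Set Data) ⊆ act → ∀ kb' ∈ upd kb a, kb' ∈ KB
  trig : ℕ → Finset OpStmt → Finset Data → Finset OpStmt
  trig_subset : ∀ T H kb, trig T H kb ⊆ H

namespace ContextKind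

/-- The operational statements `o(s)` with `o ∈ OP` and `s` an element of some knowledge base. -/
def opStmts (C : ContextKind) : Set OpStmt :=
  {h | h.1 ∈ C.OP ∧ ∃ kb ∈ C.KB, h.2 ∈ kb}

/-- Management, update and triggering function are computable in polynomial time, finite sets
being presented by lists. -/
def IsPolyTime (C : ContextKind) : Prop :=
  (∃ f, PolyTime f ∧ ∀ (H : List OpStmt) (kb : List Data),
    (∀ h ∈ H, h ∈ C.opStmts) → kb.toFinset ∈ C.KB →
      (f (.node (.ofList (H.map OpStmt.enc)) (.ofList kb))).toFinset
        = C.mng H.toFinset kb.toFinset) ∧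
  (∃ f, PolyTime f ∧ ∀ (kb a : List Data), kb.toFinset ∈ C.KB → (∀ e ∈ a, e ∈ C.act) →
      ((f (.node (.ofList kb) (.ofList a))).toList.map Data.toFinset).toFinset
        = C.upd kb.toFinset a.toFinset) ∧
  (∃ f, PolyTime f ∧ ∀ (T : ℕ) (H : List OpStmt) (kb : List Data),
    (∀ h ∈ H, h ∈ C.opStmts) → kb.toFinset ∈ C.KB →
      (f (.node (.ofNat T) (.node (.ofList (H.map OpStmt.enc)) (.ofList kb)))).toFinset
        = (C.trig T H.toFinset kb.toFinset).image OpStmt.enc)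

/-- Some action leaves every knowledge base unchanged, and so does management when there is no
operational statement to process. -/
def IsNeutral (C : ContextKind) : Prop :=
  (∃ a : Finset Data, (a : Set Data) ⊆ C.act ∧ ∀ kb ∈ C.KB, C.upd kb a = {kb}) ∧
  ∀ kb ∈ C.KB, C.mng ∅ kb = kb

/-- Code of an instance of the context problem: the set `H` of the heads of the bridge rules
that are applicable in the projected belief state, the current knowledge base `kb`, the set `R` of
relevant beliefs of the context, and the element `P` of the projected belief state. -/
def encContextInstance (H : List OpStmt) (kb R P : List Data) : Data :=
  .node (.node (.ofList (H.map OpStmt.enc)) (.ofList kb)) (.node (.ofList R) (.ofList P))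

/-- The context problem: is the given projected belief set `P ⊆ R` the projection to `R` of a
belief set that is acceptable for the knowledge base `mng H kb`? -/
def contextProblem (C : ContextKind) : DecisionProblem where
  instances := {x | ∃ (H : List OpStmt) (kb R P : List Data),
    x = encContextInstance H kb R P ∧
    (∀ h ∈ H, h ∈ C.opStmts) ∧ kb.toFinset ∈ C.KB ∧ P ⊆ R}
  yes := {x | ∃ (H : List OpStmt) (kb R P : List Data),
    x = encContextInstance H kb R P ∧
    (∀ h ∈ H, h ∈ C.opStmts) ∧ kb.toFinset ∈ C.KB ∧ P ⊆ R ∧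
    ∃ S ∈ C.ACC (C.mng H.toFinset kb.toFinset), S ∩ R.toFinset = P.toFinset}

/-- Plain fact bases: the only acceptable belief set is the set of stored facts; management stores
the facts received through bridge rules, actions store facts, and all bridge rules are triggered. -/
def factBase : ContextKind where
  KB := Set.univ
  Cn := Set.univ
  ACC kb := {kb}
  ACC_subset _ _ := Set.subset_univ _
  OP := Set.univ
  mng H kb := kb ∪ H.image Prod.snd
  mng_mem _ _ _ _ := Set.mem_univ _
  act := Set.univ
  upd kb a := {kb ∪ a}
  upd_nonempty _ _ _ _ := Finset.singleton_nonempty _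
  upd_mem _ _ _ _ _ _ := Set.mem_univ _
  trig _ H _ := H
  trig_subset _ _ _ := Finset.Subset.refl _

end ContextKind

/-- A finite supply of kinds of contexts from which systems are composed. -/
structure Library where
  K : ℕ
  kind : Fin K → ContextKind

namespace Library

def IsPolyTime (𝓛 : Library) : Prop := ∀ k, (𝓛.kind k).IsPolyTime

def IsNeutral (𝓛 : Library) : Prop := ∀ k, (𝓛.kind k).IsNeutral

/-- The library in which also plain fact bases are available. -/
def withFactBase (𝓛 : Library) : Library where
  K := 𝓛.K + 1
  kind := Fin.cons ContextKind.factBase 𝓛.kind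

/-- The class `𝒞` is an upper bound for the complexity of all context problems. -/
def SystemContextComplexityIn (𝓛 : Library) (𝒞 : Set (Set Data)) : Prop :=
  ∀ k, (𝓛.kind k).contextProblem.MemClass 𝒞

/-- The join of the context problems, which is their least upper bound with respect to
polynomial-time reducibility. -/
def systemContextProblem (𝓛 : Library) : DecisionProblem where
  instances := {x | ∃ (k : Fin 𝓛.K) (y : Data), x = .node (.ofNat k) y ∧
    y ∈ (𝓛.kind k).contextProblem.instances}
  yes := {x | ∃ (k : Fin 𝓛.K) (y : Data), x = .node (.ofNat k) y ∧
    y ∈ (𝓛.kind k).contextProblem.yes}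

end Library

/-! Timed managed multi-context systems. -/

/-- A ground bridge rule `o(s) ← (c₁:p₁), …, not (cₘ:pₘ)` in a system of `n` contexts. -/
structure BridgeRule (n : ℕ) where
  head : OpStmt
  pos : List (Fin n × Data)
  neg : List (Fin n × Data)

/-- The body holds in a belief state. -/
def BridgeRule.Holds {n : ℕ} (ρ : BridgeRule n) (S : Fin n → Finset Data) : Prop :=
  (∀ b ∈ ρ.pos, b.2 ∈ S b.1) ∧ ∀ b ∈ ρ.neg, b.2 ∉ S b.1

def BridgeRule.enc {n : ℕ} (ρ : BridgeRule n) : Data :=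
  .node ρ.head.enc
    (.node (.ofList (ρ.pos.map fun b => .node (.ofNat b.1) b.2))
      (.ofList (ρ.neg.map fun b => .node (.ofNat b.1) b.2)))

/-- A timed managed multi-context system of `n` contexts at time `0`: the kind, the initial
knowledge base, the initial belief set and the bridge rules of each context. -/
structure System (K : ℕ) where
  n : ℕ
  kind : Fin n → Fin K
  kb : Fin n → List Data
  bel : Fin n → List Data
  rules : Fin n → List (BridgeRule n)

/-- An instance of the query problems: a system, a finite sequence of action vectors (its member
with index `T`, counted from `0`, is performed from time `T` to time `T + 1`), a context and a
belief. -/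
structure QueryInstance (K : ℕ) where
  sys : System K
  acts : List (Fin sys.n → List Data)
  ctx : Fin sys.n
  query : Data

def System.enc {K : ℕ} (M : System K) : Data :=
  .ofList (List.ofFn fun i => .node (.node (.ofNat (M.kind i)) (.ofList (M.kb i)))
    (.node (.ofList (M.bel i)) (.ofList ((M.rules i).map BridgeRule.enc))))

def QueryInstance.enc {K : ℕ} (I : QueryInstance K) : Data :=
  .node
    (.node I.sys.enc (.ofList (I.acts.map fun a => .ofList (List.ofFn fun i => .ofList (a i)))))
    (.node (.ofNat I.ctx) I.query)

namespace Library

/-- The data of the instance belong to the respective logics, management bases and action sets. -/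
def Valid (𝓛 : Library) (I : QueryInstance 𝓛.K) : Prop :=
  ∀ i : Fin I.sys.n,
    (I.sys.kb i).toFinset ∈ (𝓛.kind (I.sys.kind i)).KB ∧
    (I.sys.bel i).toFinset ∈ (𝓛.kind (I.sys.kind i)).Cn ∧
    (∀ ρ ∈ I.sys.rules i, ρ.head ∈ (𝓛.kind (I.sys.kind i)).opStmts) ∧
    ∀ a ∈ I.acts, ∀ e ∈ a i, e ∈ (𝓛.kind (I.sys.kind i)).act

variable (𝓛 : Library) (M : System 𝓛.K)

/-- The rule `ρ` of context `i` is triggered at time `T`, given the evolution `kb` of the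
knowledge bases. -/
def Triggered (kb : ℕ → Fin M.n → Finset Data) (T : ℕ) (i : Fin M.n) (ρ : BridgeRule M.n) : Prop :=
  ρ.head ∈ (𝓛.kind (M.kind i)).trig T ((M.rules i).map BridgeRule.head).toFinset (kb T i)

open Classical in
/-- The heads of the bridge rules of context `i` that have been triggered up to time `T` and whose
body holds at time `T`. -/
noncomputable def app (kb S : ℕ → Fin M.n → Finset Data) (T : ℕ) (i : Fin M.n) : Finset OpStmt :=
  (((M.rules i).filter fun ρ =>
    decide ((∃ T' ≤ T, 𝓛.Triggered M kb T' i ρ) ∧ ρ.Holds (S T))).map BridgeRule.head).toFinset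

/-- Evolution of the system up to time `t` under a sequence of action vectors: from time `T` to
`T + 1` the knowledge base is updated, and the heads applicable at time `T` are incorporated; the
belief state at each of the times `1, …, t` is acceptable for the knowledge bases managed with the
heads that are applicable in it. -/
def IsRun (acts : List (Fin M.n → List Data)) (t : ℕ) (kb S : ℕ → Fin M.n → Finset Data) : Prop :=
  (∀ i, kb 0 i = (M.kb i).toFinset ∧ S 0 i = (M.bel i).toFinset) ∧
  ∀ T < t, ∃ a, acts[T]? = some a ∧ ∀ i,
    (∃ kb' ∈ (𝓛.kind (M.kind i)).upd (kb T i) (a i).toFinset,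
      kb (T + 1) i = (𝓛.kind (M.kind i)).mng (𝓛.app M kb S T i) kb') ∧
    S (T + 1) i ∈ (𝓛.kind (M.kind i)).ACC
      ((𝓛.kind (M.kind i)).mng (𝓛.app M kb S (T + 1) i) (kb (T + 1) i))

/-- `E` is a timed equilibrium at time `t ≥ 1`. -/
def IsTimedEquilibrium (acts : List (Fin M.n → List Data)) (t : ℕ) (E : Fin M.n → Finset Data) :
    Prop :=
  1 ≤ t ∧ ∃ kb S, 𝓛.IsRun M acts t kb S ∧ S t = E

/-- The answer to the existential query is *yes*. -/
def QExistsHolds (I : QueryInstance 𝓛.K) : Prop :=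
  ∃ t' ≤ I.acts.length, ∃ E, 𝓛.IsTimedEquilibrium I.sys I.acts t' E ∧ I.query ∈ E I.ctx

/-- The answer to the universal query is *yes*. -/
def QForallHolds (I : QueryInstance 𝓛.K) : Prop :=
  ∀ t' ≤ I.acts.length, ∀ E, 𝓛.IsTimedEquilibrium I.sys I.acts t' E → I.query ∈ E I.ctx

/-- The existential query problem for update sequences of length at most `N`. -/
def QExists (N : ℕ∞) : DecisionProblem where
  instances := {x | ∃ I : QueryInstance 𝓛.K, x = I.enc ∧ 𝓛.Valid I ∧ (I.acts.length : ℕ∞) ≤ N}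
  yes := {x | ∃ I : QueryInstance 𝓛.K, x = I.enc ∧ 𝓛.Valid I ∧ (I.acts.length : ℕ∞) ≤ N ∧
    𝓛.QExistsHolds I}

/-- The universal query problem for update sequences of length at most `N`. -/
def QForall (N : ℕ∞) : DecisionProblem where
  instances := {x | ∃ I : QueryInstance 𝓛.K, x = I.enc ∧ 𝓛.Valid I ∧ (I.acts.length : ℕ∞) ≤ N}
  yes := {x | ∃ I : QueryInstance 𝓛.K, x = I.enc ∧ 𝓛.Valid I ∧ (I.acts.length : ℕ∞) ≤ N ∧
    𝓛.QForallHolds I}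

/-- The knowledge bases that occur in a run have size polynomial in the size of the instance. -/
def PolyGrowth : Prop :=
  ∃ q : Polynomial ℕ, ∀ I : QueryInstance 𝓛.K, 𝓛.Valid I → ∀ t kb S,
    𝓛.IsRun I.sys I.acts t kb S → ∀ T ≤ t, ∀ i,
      ∑ s ∈ kb T i, (s.size + 1) ≤ q.eval I.enc.size

end Library

end TMCS

/-! Membership is guess and check. A certificate gives the length of a run and, for each time and
context, a knowledge base and the projection of the belief set to the relevant beliefs, those in
rule bodies or in the query. Bodies mention relevant beliefs only, and triggering depends only on
knowledge bases, so this table already determines the applicable heads (`toFinset_applicableHeads`).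
Hence every condition on a run can be checked in polynomial time except acceptability, which splits
into separate context problems, one for each context and time. All of them must have answer yes, so
the test is a nondeterministic conjunctive reduction: `sound` glues locally chosen acceptable belief
sets into a run, and `complete` projects a run to a certificate. An oracle for the join of the
context problems answers the list of queries, which yields `NPRel`; a closed class absorbs the
reduction itself. The universal query is handled through runs whose final belief set misses the
query. Certificates are short if knowledge bases are; when the number of steps is bounded by a
constant, iterating a polynomial one-step bound suffices (`exists_growth_bound`).

Hardness needs one time step and two contexts. Applying `mng H` in advance turns a context problem
into a question about `ACC` of one knowledge base, which a context without rules keeps under the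
neutral action. A fact base reads the belief set of that context through bridge rules and stores
either yes or no (`isTimedEquilibrium_iff`); the existential query asks for yes, the universal one
for no.

Both halves rest on a small theory of polynomial-time programs, whose main point is that a loop is
polynomial once the number of its rounds and the sizes of its states are (`PolyTimeWith.loop`). -/

namespace TMCS

/-! ### Sizes and codes of lists and numbers -/

namespace Data

theorem size_pos (d : Data) : 0 < d.size := by
  cases d <;> simp [size]

theorem size_left_le (d : Data) : d.left.size ≤ d.size := by
  cases d <;> simp [size, left]; omega

theorem size_right_le (d : Data) : d.right.size ≤ d.size := by
  cases d <;> simp [size, right]; omega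

@[simp] theorem left_node (a b : Data) : (node a b).left = a := rfl

@[simp] theorem right_node (a b : Data) : (node a b).right = b := rfl

@[simp] theorem ofList_toList (d : Data) : ofList d.toList = d := by
  induction d with
  | leaf => rfl
  | node a b _ ih => simp [ofList, toList, ih]

attribute [simp] toList_ofList

@[simp] theorem toList_leaf : leaf.toList = [] := rfl

@[simp] theorem toList_node (a b : Data) : (node a b).toList = a :: b.toList := rfl

theorem ofList_injective : Function.Injective ofList :=
  Function.LeftInverse.injective toList_ofList

theorem ofList_eq_leaf {l : List Data} : ofList l = leaf ↔ l = [] := by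
  cases l <;> simp [ofList]

theorem size_ofList (l : List Data) : (ofList l).size = 1 + (l.map fun a => a.size + 1).sum := by
  induction l with
  | nil => rfl
  | cons a l ih => simp [ofList, size, ih]; omega

theorem size_le_of_mem_toList {a d : Data} (h : a ∈ d.toList) : a.size ≤ d.size := by
  induction d with
  | leaf => simp at h
  | node b c _ ih =>
    simp only [toList_node, List.mem_cons] at h
    simp only [size]
    rcases h with rfl | h
    · omega
    · have := ih h; omega

theorem length_toList_lt (d : Data) : d.toList.length < d.size := by
  induction d with
  | leaf => simp [size]
  | node a b _ ih => simp [size]; omega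

theorem size_ofList_le {l : List Data} {B : ℕ} (h : ∀ a ∈ l, a.size ≤ B) :
    (ofList l).size ≤ 1 + l.length * (B + 1) := by
  induction l with
  | nil => simp [ofList, size]
  | cons a l ih =>
    have h1 := h a (by simp)
    have h2 := ih fun b hb => h b (by simp [hb])
    simp only [ofList, size, List.length_cons]
    linarith

theorem size_ofList_sublist {l l' : List Data} (h : l.Sublist l') :
    (ofList l).size ≤ (ofList l').size := by
  rw [size_ofList, size_ofList]
  have := (h.map fun a => a.size + 1).sum_le_sum (by simp)
  omega

@[simp] theorem length_toList_ofNat (n : ℕ) : (ofNat n).toList.length = n := by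
  induction n with
  | zero => rfl
  | succ n ih => simp [ofNat, ih]

theorem ofNat_injective : Function.Injective ofNat :=
  fun m n h => by simpa using congrArg (fun d : Data => d.toList.length) h

theorem size_ofNat (n : ℕ) : (ofNat n).size = 2 * n + 1 := by
  induction n with
  | zero => rfl
  | succ n ih => simp [ofNat, size, ih]; omega

/-- The list element with the given (unary) index, `leaf` if there is none. -/
def nth (d i : Data) : Data := (i.toList.foldl (fun acc _ => acc.right) d).left

theorem nth_ofList {l : List Data} {k : ℕ} (h : k < l.length) : (ofList l).nth (ofNat k) = l[k] := by
  induction k generalizing l with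
  | zero => cases l with
    | nil => simp at h
    | cons a l => rfl
  | succ k ih => cases l with
    | nil => simp at h
    | cons a l =>
      simp only [List.length_cons, Nat.add_lt_add_iff_right] at h
      exact ih h

/-- The list of the numbers below the length of a list, in descending order. -/
def range (d : Data) : Data := ofList ((List.range d.toList.length).reverse.map ofNat)

theorem mem_range {d a : Data} : a ∈ d.range.toList ↔ ∃ k < d.toList.length, a = ofNat k := by
  simp [range, eq_comm]

open Classical in
/-- The truth value of a proposition. -/
noncomputable def ofProp (p : Prop) : Data := if p then node leaf leaf else leaf

@[simp] theorem ofProp_eq_leaf {p : Prop} : ofProp p = leaf ↔ ¬p := by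
  by_cases h : p <;> simp [ofProp, h]

end Data

open Data

/-! ### Costs, output sizes and removal of oracle calls -/

theorem polynomial_eval_mono (q : Polynomial ℕ) : Monotone fun n => q.eval n := by
  intro m n h
  induction q using Polynomial.induction_on' with
  | add p q hp hq => simpa using add_le_add hp hq
  | monomial k a => simpa using Nat.mul_le_mul_left a (Nat.pow_le_pow_left h k)

/-- Every evaluation rule charges at least the size of what it outputs. So a cost bound is also an
output bound, which is what makes compositions polynomial. -/
theorem Eval.size_le {A : Set Data} {c : Code} {x y : Data} {n : ℕ} (h : Eval A c x y n) :
    y.size ≤ n := by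
  induction h with
  | left x => exact x.size_left_le
  | right x => exact x.size_right_le
  | oracleTrue => simp only [size]; have := Data.size_pos ‹_›; omega
  | _ => first | omega | (simp only [size] at *; omega)

/-- Replaces oracle calls by the answer *false*. -/
def Code.eraseOracle : Code → Code
  | .pair f g => .pair f.eraseOracle g.eraseOracle
  | .comp f g => .comp f.eraseOracle g.eraseOracle
  | .cond c f g => .cond c.eraseOracle f.eraseOracle g.eraseOracle
  | .loop c f => .loop c.eraseOracle f.eraseOracle
  | .oracle => .leaf
  | c => c

/-- A program run with the empty oracle may still contain oracle calls, but they all return `leaf`.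
Replacing them by the constant, which is cheaper, makes the result independent of the oracle. -/
theorem Eval.eraseOracle (A : Set Data) {c : Code} {x y : Data} {n : ℕ} (h : Eval ∅ c x y n) :
    ∃ m ≤ n, Eval A c.eraseOracle x y m := by
  induction h with
  | leaf x => exact ⟨_, le_rfl, .leaf x⟩
  | id x => exact ⟨_, le_rfl, .id x⟩
  | left x => exact ⟨_, le_rfl, .left x⟩
  | right x => exact ⟨_, le_rfl, .right x⟩
  | pair _ _ ih1 ih2 =>
    obtain ⟨m1, h1, e1⟩ := ih1
    obtain ⟨m2, h2, e2⟩ := ih2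
    exact ⟨_, by omega, .pair e1 e2⟩
  | comp _ _ ih1 ih2 =>
    obtain ⟨m1, h1, e1⟩ := ih1
    obtain ⟨m2, h2, e2⟩ := ih2
    exact ⟨_, by omega, .comp e1 e2⟩
  | condTrue _ hy _ ih1 ih2 =>
    obtain ⟨m1, h1, e1⟩ := ih1
    obtain ⟨m2, h2, e2⟩ := ih2
    exact ⟨_, by omega, .condTrue e1 hy e2⟩
  | condFalse _ _ ih1 ih2 =>
    obtain ⟨m1, h1, e1⟩ := ih1
    obtain ⟨m2, h2, e2⟩ := ih2
    exact ⟨_, by omega, .condFalse e1 e2⟩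
  | loopDone _ ih1 =>
    obtain ⟨m1, h1, e1⟩ := ih1
    exact ⟨_, by omega, .loopDone e1⟩
  | loopStep _ hy _ _ ih1 ih2 ih3 =>
    obtain ⟨m1, h1, e1⟩ := ih1
    obtain ⟨m2, h2, e2⟩ := ih2
    obtain ⟨m3, h3, e3⟩ := ih3
    exact ⟨_, by omega, .loopStep e1 hy e2 e3⟩
  | oracleTrue h => exact absurd h (Set.notMem_empty _)
  | oracleFalse _ => exact ⟨_, by omega, .leaf _⟩

/-! Closure properties of the polynomial-time computable functions. -/

namespace PolyTimeWith

variable {A : Set Data} {f g h : Data → Data}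

theorem of_polyTime (hf : PolyTime f) : PolyTimeWith A f := by
  obtain ⟨c, q, hc⟩ := hf
  refine ⟨c.eraseOracle, q, fun x => ?_⟩
  obtain ⟨n, hn, e⟩ := hc x
  obtain ⟨m, hm, e⟩ := e.eraseOracle A
  exact ⟨m, hm.trans hn, e⟩

theorem congr (hf : PolyTimeWith A f) (h : ∀ x, f x = g x) : PolyTimeWith A g := by
  rwa [show g = f from funext fun x => (h x).symm]

theorem size_le (hf : PolyTimeWith A f) :
    ∃ q : Polynomial ℕ, ∀ x, (f x).size ≤ q.eval x.size := by
  obtain ⟨c, q, hc⟩ := hf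
  refine ⟨q, fun x => ?_⟩
  obtain ⟨n, hn, e⟩ := hc x
  exact e.size_le.trans hn

protected theorem id : PolyTimeWith A fun x => x :=
  ⟨.id, .X, fun x => ⟨_, by simp, .id x⟩⟩

theorem comp (hf : PolyTimeWith A f) (hg : PolyTimeWith A g) :
    PolyTimeWith A fun x => f (g x) := by
  obtain ⟨c, q, hc⟩ := hf
  obtain ⟨d, r, hd⟩ := hg
  refine ⟨.comp c d, r + q.comp r + 1, fun x => ?_⟩
  obtain ⟨n, hn, e⟩ := hd x
  obtain ⟨m, hm, e'⟩ := hc (g x)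
  have := polynomial_eval_mono q (e.size_le.trans hn)
  refine ⟨_, ?_, .comp e e'⟩
  simp only [Polynomial.eval_add, Polynomial.eval_comp, Polynomial.eval_one] at *
  omega

protected theorem left (hf : PolyTimeWith A f) : PolyTimeWith A fun x => (f x).left :=
  comp (f := Data.left) ⟨.left, .X, fun x => ⟨_, by simp, .left x⟩⟩ hf

protected theorem right (hf : PolyTimeWith A f) : PolyTimeWith A fun x => (f x).right :=
  comp (f := Data.right) ⟨.right, .X, fun x => ⟨_, by simp, .right x⟩⟩ hf

protected theorem node (hf : PolyTimeWith A f) (hg : PolyTimeWith A g) :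
    PolyTimeWith A fun x => Data.node (f x) (g x) := by
  obtain ⟨c, q, hc⟩ := hf
  obtain ⟨d, r, hd⟩ := hg
  refine ⟨.pair c d, q + r + 1, fun x => ?_⟩
  obtain ⟨n, hn, e⟩ := hc x
  obtain ⟨m, hm, e'⟩ := hd x
  refine ⟨_, ?_, .pair e e'⟩
  simp only [Polynomial.eval_add, Polynomial.eval_one]
  omega

theorem const (d : Data) : PolyTimeWith A fun _ => d := by
  induction d with
  | leaf => exact ⟨.leaf, 1, fun x => ⟨_, by simp, .leaf x⟩⟩
  | node a b iha ihb => exact iha.node ihb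

open Classical in
theorem cond (hf : PolyTimeWith A f) (hg : PolyTimeWith A g) (hh : PolyTimeWith A h) :
    PolyTimeWith A fun x => if f x = Data.leaf then h x else g x := by
  obtain ⟨c, q, hc⟩ := hf
  obtain ⟨d, r, hd⟩ := hg
  obtain ⟨e, s, he⟩ := hh
  refine ⟨.cond c d e, q + r + s + 1, fun x => ?_⟩
  simp only [Polynomial.eval_add, Polynomial.eval_one]
  obtain ⟨n, hn, e1⟩ := hc x
  by_cases hx : f x = Data.leaf
  · obtain ⟨m, hm, e2⟩ := he x
    rw [hx] at e1
    exact ⟨n + m + 1, by omega, by simpa [hx] using .condFalse e1 e2⟩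
  · obtain ⟨m, hm, e2⟩ := hd x
    exact ⟨n + m + 1, by omega, by simpa [hx] using .condTrue e1 hx e2⟩

end PolyTimeWith

/-- `k` rounds of the loop `while c, apply f` lead from one state to another, all states on the way
having size at most `B`. -/
inductive LoopRun (c f : Data → Data) (B : ℕ) : ℕ → Data → Data → Prop
  | refl {x : Data} : x.size ≤ B → LoopRun c f B 0 x x
  | step {x y : Data} {k : ℕ} : c x ≠ leaf → x.size ≤ B → LoopRun c f B k (f x) y →
      LoopRun c f B (k + 1) x y

theorem LoopRun.trans {c f : Data → Data} {B k m : ℕ} {x y z : Data} (h : LoopRun c f B k x y)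
    (h' : LoopRun c f B m y z) : LoopRun c f B (k + m) x z := by
  induction h with
  | refl _ => simpa using h'
  | @step x y k hc hx _ ih =>
    rw [Nat.add_right_comm]
    exact .step hc hx (ih h')

/-- Since all states have size at most `B`, monotonicity bounds the cost of each round uniformly;
the additional factor 1 pays for the last test and for copying the result. -/
theorem LoopRun.eval {A : Set Data} {c f : Data → Data} {cc cf : Code} {qc qf : Polynomial ℕ}
    (hc : ∀ x, ∃ n ≤ qc.eval x.size, Eval A cc x (c x) n)
    (hf : ∀ x, ∃ n ≤ qf.eval x.size, Eval A cf x (f x) n) {B k : ℕ} {x y : Data}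
    (h : LoopRun c f B k x y) (hy : c y = leaf) :
    ∃ n ≤ (k + 1) * (qc.eval B + qf.eval B + B + 1), Eval A (.loop cc cf) x y n := by
  induction h with
  | @refl x hx =>
    obtain ⟨n, hn, e⟩ := hc x
    rw [hy] at e
    have := polynomial_eval_mono qc hx
    exact ⟨_, by simp only at *; omega, .loopDone e⟩
  | @step x y k hcx hx _ ih =>
    obtain ⟨n, hn, e⟩ := hc x
    obtain ⟨m, hm, e'⟩ := hf x
    obtain ⟨r, hr, e''⟩ := ih hy
    have h1 := polynomial_eval_mono qc hx
    have h2 := polynomial_eval_mono qf hx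
    refine ⟨_, ?_, .loopStep e hcx e' e''⟩
    simp only at *
    rw [add_mul _ 1, one_mul]
    omega

/-! ### Loops, folds and list operations -/

namespace PolyTimeWith

variable {A : Set Data} {f g h : Data → Data}

theorem loop {c f init r : Data → Data} (hc : PolyTimeWith A c) (hf : PolyTimeWith A f)
    (hinit : PolyTimeWith A init) (Q B : Polynomial ℕ)
    (hr : ∀ x, ∃ k ≤ Q.eval x.size, LoopRun c f (B.eval x.size) k (init x) (r x) ∧
      c (r x) = Data.leaf) : PolyTimeWith A r := by
  obtain ⟨cc, qc, hc⟩ := hc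
  obtain ⟨cf, qf, hf⟩ := hf
  obtain ⟨ci, qi, hi⟩ := hinit
  refine ⟨.comp (.loop cc cf) ci, qi + (Q + 1) * (qc.comp B + qf.comp B + B + 1) + 1,
    fun x => ?_⟩
  obtain ⟨k, hk, hrun, hend⟩ := hr x
  obtain ⟨n, hn, e⟩ := hi x
  obtain ⟨m, hm, e'⟩ := hrun.eval hc hf hend
  refine ⟨_, ?_, .comp e e'⟩
  have := hm.trans (Nat.mul_le_mul_right _ (Nat.add_le_add_right hk 1))
  simp only [Polynomial.eval_add, Polynomial.eval_one, Polynomial.eval_mul, Polynomial.eval_comp]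
  omega

/-- The loop state is `node x (node rest acc)`, and the loop runs while `rest` is nonempty.
Iterating a polynomial-time step can blow up the accumulator exponentially, so a bound on all
intermediate accumulators, that is, over all prefixes of the list, is required. -/
theorem foldl {s : Data → Data → Data → Data} {l a₀ : Data → Data}
    (hs : PolyTimeWith A fun z => s z.left z.right.left z.right.right)
    (hl : PolyTimeWith A l) (ha : PolyTimeWith A a₀) (B : Polynomial ℕ)
    (hB : ∀ x, ∀ l', l' <+: (l x).toList → (l'.foldl (fun acc a => s x a acc) (a₀ x)).size ≤
      B.eval x.size) :
    PolyTimeWith A fun x => (l x).toList.foldl (fun acc a => s x a acc) (a₀ x) := by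
  obtain ⟨ql, hql⟩ := hl.size_le
  let c : Data → Data := fun z => z.right.left
  let f : Data → Data := fun z => .node z.left (.node z.right.left.right
    (s z.left z.right.left.left z.right.right))
  have hc : PolyTimeWith A c := PolyTimeWith.id.right.left
  have hf : PolyTimeWith A f := PolyTimeWith.id.left.node (PolyTimeWith.id.right.left.right.node
    (hs.comp (g := fun z => .node z.left (.node z.right.left.left z.right.right))
      (PolyTimeWith.id.left.node (PolyTimeWith.id.right.left.left.node PolyTimeWith.id.right.right))))
  have key : ∀ (x : Data) (L : List Data) (acc : Data) (b m : ℕ), (ofList L).size ≤ m →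
      (∀ l', l' <+: L → (l'.foldl (fun acc a => s x a acc) acc).size ≤ b) →
      LoopRun c f (x.size + m + b + 2) L.length (.node x (.node (ofList L) acc))
        (.node x (.node .leaf (L.foldl (fun acc a => s x a acc) acc))) := by
    intro x L
    induction L with
    | nil =>
      intro acc b m hm hb
      refine .refl ?_
      have := hb [] (by simp)
      simp only [List.foldl_nil, ofList, size] at *
      omega
    | cons a L ih =>
      intro acc b m hm hb
      refine .step (by simp [c, ofList]) ?_ ?_
      · have := hb [] (by simp)
        simp only [List.foldl_nil, size] at *
        omega
      · refine ih (s x a acc) b m ?_ fun l' hl' => ?_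
        · simp only [ofList, size] at *; omega
        · simpa using hb (a :: l') (by simpa using hl')
  refine (loop (init := fun x => .node x (.node (l x) (a₀ x)))
    (r := fun x => .node x (.node .leaf ((l x).toList.foldl (fun acc a => s x a acc) (a₀ x))))
    hc hf (PolyTimeWith.id.node (hl.node ha)) ql (.X + ql + B + 2) fun x => ?_).right.right
  refine ⟨_, (length_toList_lt (l x)).le.trans (hql x), ?_, rfl⟩
  have := key x (l x).toList (a₀ x) (B.eval x.size) (ql.eval x.size) (by simpa using hql x) (hB x)
  simpa using this

/-- If each step adds an amount that does not depend on the accumulator, the growth is at most the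
number of steps times that amount, which is polynomial. -/
theorem foldl_of_size_le {s : Data → Data → Data → Data} {l a₀ : Data → Data}
    (hs : PolyTimeWith A fun z => s z.left z.right.left z.right.right)
    (hl : PolyTimeWith A l) (ha : PolyTimeWith A a₀) (P : Polynomial ℕ)
    (hP : ∀ x a acc, (s x a acc).size ≤ acc.size + P.eval (Data.node x a).size) :
    PolyTimeWith A fun x => (l x).toList.foldl (fun acc a => s x a acc) (a₀ x) := by
  obtain ⟨ql, hql⟩ := hl.size_le
  obtain ⟨qa, hqa⟩ := ha.size_le
  refine foldl hs hl ha (qa + ql * P.comp (.X + ql + 1)) fun x l' hl' => ?_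
  have key : ∀ (L : List Data) (acc : Data) (b : ℕ), (∀ a ∈ L, a.size ≤ b) →
      (L.foldl (fun acc a => s x a acc) acc).size ≤
        acc.size + L.length * P.eval (x.size + b + 1) := by
    intro L
    induction L with
    | nil => simp
    | cons a L ih =>
      intro acc b hb
      have h1 := ih (s x a acc) b fun c hc => hb c (by simp [hc])
      have h2 := hP x a acc
      have h3 : P.eval (Data.node x a).size ≤ P.eval (x.size + b + 1) :=
        polynomial_eval_mono P (by have := hb a (by simp); simp only [size]; omega)
      simp only [List.foldl_cons, List.length_cons, add_mul, one_mul]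
      omega
  have h1 := key l' (a₀ x) (ql.eval x.size) fun a h =>
    (size_le_of_mem_toList (hl'.subset h)).trans (hql x)
  have h2 : l'.length ≤ ql.eval x.size :=
    hl'.length_le.trans ((length_toList_lt (l x)).le.trans (hql x))
  have h3 := Nat.mul_le_mul_right (P.eval (x.size + ql.eval x.size + 1)) h2
  have h4 := hqa x
  simp only [Polynomial.eval_add, Polynomial.eval_mul, Polynomial.eval_comp, Polynomial.eval_X,
    Polynomial.eval_one]
  omega

theorem reverseAppend (hf : PolyTimeWith A f) (hg : PolyTimeWith A g) :
    PolyTimeWith A fun x => ofList ((f x).toList.reverse ++ (g x).toList) := by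
  have := foldl_of_size_le (A := A) (s := fun _ a acc => .node a acc) (l := f) (a₀ := g)
    (PolyTimeWith.id.right.left.node PolyTimeWith.id.right.right) hf hg (.X + 1)
    (fun x a acc => by simp [size]; omega)
  refine PolyTimeWith.congr this fun x => ?_
  generalize (f x).toList = L
  generalize g x = acc
  induction L generalizing acc with
  | nil => simp
  | cons a L ih => simp [ih]

theorem reverse (hf : PolyTimeWith A f) : PolyTimeWith A fun x => ofList (f x).toList.reverse := by
  simpa using hf.reverseAppend (const .leaf)

theorem append (hf : PolyTimeWith A f) (hg : PolyTimeWith A g) :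
    PolyTimeWith A fun x => ofList ((f x).toList ++ (g x).toList) := by
  simpa using hf.reverse.reverseAppend hg

/-- The accumulator holds the output backwards, so that each piece is put in front by
`reverseAppend` and adds only its own size; a final reversal restores the order. -/
theorem flatMap {F : Data → Data → Data} {l : Data → Data} (hl : PolyTimeWith A l)
    (hF : PolyTimeWith A fun z => F z.left z.right) :
    PolyTimeWith A fun x => ofList ((l x).toList.flatMap fun a => (F x a).toList) := by
  obtain ⟨q, hq⟩ := hF.size_le
  have := foldl_of_size_le (A := A)
    (s := fun x a acc => ofList ((F x a).toList.reverse ++ acc.toList))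
    (l := l) (a₀ := fun _ => .leaf)
    (reverseAppend (hF.comp (g := fun z => .node z.left z.right.left)
      (PolyTimeWith.id.left.node PolyTimeWith.id.right.left)) PolyTimeWith.id.right.right)
    hl (const _) q (fun x a acc => by
      have h1 := hq (.node x a)
      have h2 : (ofList ((F x a).toList.reverse ++ acc.toList)).size + 1 =
          (ofList (F x a).toList).size + (ofList acc.toList).size := by
        simp only [size_ofList, List.map_append, List.map_reverse, List.sum_append,
          List.sum_reverse]
        omega
      simp only [ofList_toList, left_node, right_node] at *
      omega)
  refine PolyTimeWith.congr this.reverse fun x => ?_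
  have key : ∀ (L : List Data) (acc : Data),
      (L.foldl (fun acc a => ofList ((F x a).toList.reverse ++ acc.toList)) acc).toList.reverse =
        acc.toList.reverse ++ L.flatMap fun a => (F x a).toList := by
    intro L
    induction L with
    | nil => simp
    | cons a L ih => intro acc; simp [ih]
  rw [key]; simp

theorem map {F : Data → Data → Data} {l : Data → Data} (hl : PolyTimeWith A l)
    (hF : PolyTimeWith A fun z => F z.left z.right) :
    PolyTimeWith A fun x => ofList ((l x).toList.map (F x)) := by
  have := hl.flatMap (F := fun x a => .node (F x a) .leaf) (hF.node (const _))
  simpa [← List.map_eq_flatMap] using this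

protected theorem nth (hf : PolyTimeWith A f) (hg : PolyTimeWith A g) :
    PolyTimeWith A fun x => (f x).nth (g x) :=
  (foldl_of_size_le (s := fun _ _ acc => acc.right) PolyTimeWith.id.right.right.right hg hf 0
    (fun _ _ acc => by simpa using acc.size_right_le)).left

theorem range (hf : PolyTimeWith A f) : PolyTimeWith A fun x => (f x).range := by
  obtain ⟨q, hq⟩ := hf.size_le
  -- The head of the accumulator is the largest number so far, and each step puts its successor in
  -- front. As the fold starts with the list of `0` alone, it ends with one number too many, which
  -- the final `.right` removes.
  have key : ∀ L : List Data, L.foldl (fun acc _ => .node (.node .leaf acc.left) acc)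
      (.node .leaf .leaf) = ofList ((List.range (L.length + 1)).reverse.map ofNat) := by
    intro L
    induction L using List.reverseRecOn with
    | nil => rfl
    | append_singleton L a ih =>
      rw [List.foldl_append, ih]
      simp [List.range_succ, ofList, ofNat]
  have := foldl (A := A) (s := fun _ _ acc => .node (.node .leaf acc.left) acc) (l := f)
    (a₀ := fun _ => .node .leaf .leaf)
    (((const _).node PolyTimeWith.id.right.right.left).node PolyTimeWith.id.right.right) hf
    -- At most `q + 1` numbers, each with a unary code of size at most `2 * q + 1`. The additive
    -- criterion does not apply, since what a step adds depends on the accumulator.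
    (const _) (1 + (q + 1) * (2 * q + 1 + 1)) (fun x l' hl' => by
      have h1 : l'.length ≤ q.eval x.size :=
        hl'.length_le.trans ((length_toList_lt (f x)).le.trans (hq x))
      rw [key]
      refine (size_ofList_le (B := 2 * q.eval x.size + 1) ?_).trans ?_
      · intro a ha
        simp only [List.map_reverse, List.mem_reverse, List.mem_map, List.mem_range] at ha
        obtain ⟨k, hk, rfl⟩ := ha
        rw [size_ofNat]; omega
      · simp only [List.length_map, List.length_reverse, List.length_range, Polynomial.eval_add,
          Polynomial.eval_one, Polynomial.eval_mul, Polynomial.eval_ofNat]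
        gcongr)
  refine PolyTimeWith.congr this.right fun x => ?_
  rw [key]
  simp [Data.range, List.range_succ, ofList]

end PolyTimeWith

/-- The property `p` is decidable in polynomial time with oracle `A`. -/
def PolyDec (A : Set Data) (p : Data → Prop) : Prop := PolyTimeWith A fun x => ofProp (p x)

/-! ### Polynomial-time decidable predicates -/

namespace PolyDec

variable {A : Set Data} {p q : Data → Prop} {f g : Data → Data}

theorem congr (hp : PolyDec A p) (h : ∀ x, p x ↔ q x) : PolyDec A q := by
  rwa [show q = p from funext fun x => propext (h x).symm]

theorem ite [∀ x, Decidable (p x)] (hp : PolyDec A p) (hf : PolyTimeWith A f) (hg : PolyTimeWith A g) :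
    PolyTimeWith A fun x => if p x then f x else g x := by
  have := PolyTimeWith.cond hp hf hg
  refine PolyTimeWith.congr this fun x => ?_
  by_cases h : p x <;> simp [h]

theorem of_eq_leaf (hf : PolyTimeWith A f) : PolyDec A fun x => f x = Data.leaf := by
  have := hf.cond (PolyTimeWith.const .leaf) (PolyTimeWith.const (.node .leaf .leaf))
  refine PolyTimeWith.congr this fun x => ?_
  by_cases h : f x = Data.leaf <;> simp [h, ofProp]

theorem comp (hp : PolyDec A p) (hf : PolyTimeWith A f) : PolyDec A fun x => p (f x) :=
  PolyTimeWith.comp hp hf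

protected theorem not (hp : PolyDec A p) : PolyDec A fun x => ¬p x :=
  (of_eq_leaf hp).congr fun x => by simp

protected theorem and (hp : PolyDec A p) (hq : PolyDec A q) : PolyDec A fun x => p x ∧ q x := by
  classical
  have := hp.ite hq (PolyTimeWith.const .leaf)
  refine PolyTimeWith.congr this fun x => ?_
  by_cases h : p x <;> by_cases h' : q x <;> simp [h, h', ofProp]

theorem filter {p : Data → Data → Prop} [∀ x a, Decidable (p x a)] (hf : PolyTimeWith A f)
    (hp : PolyDec A fun z => p z.left z.right) :
    PolyTimeWith A fun x => ofList ((f x).toList.filter fun a => decide (p x a)) := by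
  have := hf.flatMap (F := fun x a => if p x a then .node a .leaf else .leaf)
    (hp.ite (PolyTimeWith.id.right.node (PolyTimeWith.const _)) (PolyTimeWith.const _))
  refine PolyTimeWith.congr this fun x => ?_
  congr 1
  induction (f x).toList with
  | nil => rfl
  | cons a l ih => by_cases h : p x a <;> simp [h, ih]

theorem forall_mem {p : Data → Data → Prop} (hf : PolyTimeWith A f)
    (hp : PolyDec A fun z => p z.left z.right) :
    PolyDec A fun x => ∀ a ∈ (f x).toList, p x a :=   by
  classical
  exact (of_eq_leaf (filter (p := fun x a => ¬p x a) hf hp.not)).congr fun x => by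
    simp [ofList_eq_leaf]

theorem exists_mem {p : Data → Data → Prop} (hf : PolyTimeWith A f)
    (hp : PolyDec A fun z => p z.left z.right) :
    PolyDec A fun x => ∃ a ∈ (f x).toList, p x a :=
  (PolyDec.forall_mem (p := fun x a => ¬p x a) hf hp.not).not.congr fun x => by
    simp

/-- Tree equality is tested with a stack of pairs still to be compared. The state is `node stack
verdict`: a pair of leaves is popped, a pair of nodes is replaced by its two pairs of subtrees, and
a mismatch empties the stack and sets the verdict to a nonleaf. -/
theorem eq (hf : PolyTimeWith A f) (hg : PolyTimeWith A g) : PolyDec A fun x => f x = g x := by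
  let c : Data → Data := fun z => z.left
  let F : Data → Data := fun z =>
    if z.left.left.left = Data.leaf then
      if z.left.left.right = Data.leaf then .node z.left.right .leaf
      else .node .leaf (.node .leaf .leaf)
    else
      if z.left.left.right = Data.leaf then .node .leaf (.node .leaf .leaf)
      else .node (.node (.node z.left.left.left.left z.left.left.right.left)
        (.node (.node z.left.left.left.right z.left.left.right.right) z.left.right)) .leaf
  have id := PolyTimeWith.id (A := A)
  have hfail : PolyTimeWith A fun _ => Data.node .leaf (.node .leaf .leaf) := PolyTimeWith.const _
  have hF : PolyTimeWith A F := by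
    refine (of_eq_leaf id.left.left.left).ite ((of_eq_leaf id.left.left.right).ite ?_ hfail)
      ((of_eq_leaf id.left.left.right).ite hfail ?_)
    · exact id.left.right.node (PolyTimeWith.const _)
    · exact ((id.left.left.left.left.node id.left.left.right.left).node
        ((id.left.left.left.right.node id.left.left.right.right).node id.left.right)).node
          (PolyTimeWith.const _)
  -- The rest `r` of the stack is arbitrary, so that the hypotheses for the two subtrees can be
  -- chained. Splitting a pair of nodes leaves the size of the stack unchanged, hence one bound `B`
  -- serves throughout; the rounds are counted by the nodes of `a`. The 4 leaves room for the outer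
  -- node, the verdict and the failure state.
  have key : ∀ (a b r : Data) (B : ℕ), (Data.node (.node a b) r).size + 4 ≤ B →
      ∃ k ≤ a.size, LoopRun c F B k (.node (.node (.node a b) r) .leaf)
        (if a = b then .node r .leaf else .node .leaf (.node .leaf .leaf)) := by
    intro a
    induction a with
    | leaf =>
      intro b r B hB
      simp only [size] at hB
      refine ⟨1, by simp [size], .step (by simp [c]) (by simp only [size]; omega) ?_⟩
      cases b with
      | leaf =>
        simp only [F, left_node, right_node, if_true]
        exact .refl (by simp only [size]; omega)
      | node b₁ b₂ =>
        simp only [F, left_node, right_node, if_true, reduceCtorEq, if_false]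
        exact .refl (by simp only [size]; omega)
    | node a₁ a₂ ih₁ ih₂ =>
      intro b r B hB
      simp only [size] at hB
      cases b with
      | leaf =>
        refine ⟨1, by simp only [size]; omega, .step (by simp [c]) (by simp only [size]; omega) ?_⟩
        simp only [F, left_node, right_node, if_true, reduceCtorEq, if_false]
        exact .refl (by simp only [size]; omega)
      | node b₁ b₂ =>
        simp only [size] at hB
        have hstep : F (.node (.node (.node (.node a₁ a₂) (.node b₁ b₂)) r) .leaf) =
            .node (.node (.node a₁ b₁) (.node (.node a₂ b₂) r)) .leaf := by
          simp [F]
        obtain ⟨k₁, hk₁, h₁⟩ := ih₁ b₁ (.node (.node a₂ b₂) r) B (by simp only [size]; omega)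
        obtain ⟨k₂, hk₂, h₂⟩ := ih₂ b₂ r B (by simp only [size]; omega)
        by_cases e : a₁ = b₁
        · rw [if_pos e] at h₁
          refine ⟨k₁ + k₂ + 1, by simp only [size]; omega,
            .step (by simp [c]) (by simp only [size]; omega) ?_⟩
          rw [hstep]
          simpa [e] using h₁.trans h₂
        · rw [if_neg e] at h₁
          refine ⟨k₁ + 1, by simp only [size]; omega,
            .step (by simp [c]) (by simp only [size]; omega) ?_⟩
          rw [hstep]
          simpa [e] using h₁
  obtain ⟨qf, hqf⟩ := hf.size_le
  obtain ⟨qg, hqg⟩ := hg.size_le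
  have := PolyTimeWith.loop (A := A) (c := c) (f := F)
    (init := fun x => .node (.node (.node (f x) (g x)) .leaf) .leaf)
    (r := fun x => if f x = g x then .node .leaf .leaf else .node .leaf (.node .leaf .leaf))
    id.left hF (((hf.node hg).node (PolyTimeWith.const _)).node (PolyTimeWith.const _)) qf
    (qf + qg + 10) (fun x => by
      obtain ⟨k, hk, h⟩ := key (f x) (g x) .leaf (qf.eval x.size + qg.eval x.size + 10) (by
        have h1 := hqf x
        have h2 := hqg x
        simp only [size]; omega)
      refine ⟨k, hk.trans (hqf x), by simpa using h, ?_⟩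
      by_cases e : f x = g x <;> simp [e, c])
  refine (of_eq_leaf this.right).congr fun x => ?_
  by_cases e : f x = g x <;> simp [e]

theorem mem (hf : PolyTimeWith A f) (hg : PolyTimeWith A g) :
    PolyDec A fun x => f x ∈ (g x).toList :=
  (PolyDec.exists_mem (p := fun x a => f x = a) hg
    (eq (hf.comp PolyTimeWith.id.left) PolyTimeWith.id.right)).congr fun x => by simp

theorem subset (hf : PolyTimeWith A f) (hg : PolyTimeWith A g) :
    PolyDec A fun x => (f x).toList ⊆ (g x).toList :=
  (PolyDec.forall_mem (p := fun x a => a ∈ (g x).toList) hf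
    (mem PolyTimeWith.id.right (hg.comp PolyTimeWith.id.left))).congr fun x => by rfl

theorem toFinset_eq (hf : PolyTimeWith A f) (hg : PolyTimeWith A g) :
    PolyDec A fun x => (f x).toFinset = (g x).toFinset :=
  ((subset hf hg).and (subset hg hf)).congr fun x => by
    simp only [Data.toFinset, Finset.ext_iff, List.mem_toFinset, List.subset_def, iff_iff_implies_and_implies,
      forall_and]

theorem oracle (hf : PolyTimeWith A f) : PolyDec A fun x => f x ∈ A := by
  refine PolyTimeWith.comp (f := fun y => ofProp (y ∈ A)) ⟨.oracle, .X + 2, fun x => ?_⟩ hf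
  refine ⟨x.size + 2, by simp, ?_⟩
  by_cases h : x ∈ A
  · simpa [ofProp, h] using .oracleTrue h
  · simpa [ofProp, h] using .oracleFalse h

end PolyDec

/-- Induction on the number of programs: test whether the unary index is zero, otherwise strip one
layer and pass on to the remaining programs. This is where finiteness of the library enters. -/
theorem exists_polyTimeWith_dispatch {A : Set Data} {K : ℕ} (f : Fin K → Data → Data)
    (hf : ∀ k, PolyTimeWith A (f k)) :
    ∃ F, PolyTimeWith A F ∧ ∀ (k : Fin K) y, F (.node (.ofNat k) y) = f k y := by
  classical
  induction K with
  | zero => exact ⟨_, PolyTimeWith.id, fun k => k.elim0⟩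
  | succ K ih =>
    obtain ⟨F, hF, h⟩ := ih (fun k => f k.succ) fun k => hf k.succ
    have id := PolyTimeWith.id (A := A)
    refine ⟨_, (PolyDec.of_eq_leaf id.left).ite ((hf 0).comp id.right)
      (hF.comp (id.left.right.node id.right)), fun k y => ?_⟩
    refine Fin.cases ?_ (fun k => ?_) k
    · simp [ofNat]
    · simp [ofNat, h]

/-- With the same certificate, the oracle machine computes the list of queries and asks all of them.
-/
theorem NPConjReducible.mem_npOracle {L A : Set Data} (h : NPConjReducible L A) :
    L ∈ NPOracle A := by
  obtain ⟨f, p, hf, h⟩ := h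
  have hf' : PolyTimeWith A f := .of_polyTime hf
  have id := PolyTimeWith.id (A := A)
  refine ⟨fun z => ofProp ((¬f z = .leaf ∧ (f z).left = .leaf) ∧ ∀ q ∈ (f z).right.toList, q ∈ A),
    p, ?_, fun x => ?_⟩
  · exact ((PolyDec.of_eq_leaf hf').not.and (PolyDec.of_eq_leaf hf'.left)).and
      (PolyDec.forall_mem (p := fun _ q => q ∈ A) hf'.right (PolyDec.oracle id.right))
  · rw [h]
    refine exists_congr fun w => and_congr_right fun _ => ?_
    simp only [ne_eq, ofProp_eq_leaf, not_not]
    constructor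
    · rintro ⟨qs, e, hq⟩
      simpa [e] using hq
    · intro hz
      generalize f (.node x w) = d at hz
      cases d with
      | leaf => simp at hz
      | node a b =>
        simp only [left_node, right_node] at hz
        exact ⟨b.toList, by simp [hz.1.2], hz.2⟩

/-! ### Sizes of list entries and of finite sets -/

namespace Data

theorem size_nth_le (d i : Data) : (d.nth i).size ≤ d.size := by
  refine (size_left_le _).trans ?_
  generalize i.toList = L
  induction L generalizing d with
  | nil => exact le_rfl
  | cons a L ih => exact (ih d.right).trans d.size_right_le

theorem size_ofList_map_left_le (l : List Data) : (ofList (l.map left)).size ≤ (ofList l).size := by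
  induction l with
  | nil => exact le_rfl
  | cons a l ih =>
    have := a.size_left_le
    simp only [List.map_cons, ofList, size]
    omega

theorem sum_toFinset_le (l : List Data) :
    ∑ s ∈ l.toFinset, (s.size + 1) ≤ (l.map fun s => s.size + 1).sum := by
  induction l with
  | nil => simp
  | cons a l ih =>
    rw [List.toFinset_cons, List.map_cons, List.sum_cons]
    by_cases h : a ∈ l.toFinset
    · rw [Finset.insert_eq_of_mem h]; omega
    · rw [Finset.sum_insert h]; omega

theorem sum_toFinset_le_size (d : Data) : ∑ s ∈ d.toFinset, (s.size + 1) ≤ d.size := by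
  have h := sum_toFinset_le d.toList
  have h2 := size_ofList d.toList
  rw [ofList_toList] at h2
  exact h.trans (by omega)

theorem size_ofList_finset (s : Finset Data) :
    (ofList s.toList).size = 1 + ∑ a ∈ s, (a.size + 1) := by
  rw [size_ofList, Finset.sum_map_toList]

@[simp] theorem toFinset_ofList (l : List Data) : (ofList l).toFinset = l.toFinset := by
  simp [toFinset]

theorem mem_toFinset {a d : Data} : a ∈ d.toFinset ↔ a ∈ d.toList := List.mem_toFinset

end Data

theorem OpStmt.enc_injective : Function.Injective OpStmt.enc := by
  rintro ⟨a, b⟩ ⟨c, d⟩ h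
  simpa [OpStmt.enc] using h

/-- Polynomial-time programs that serve all kinds of a library, the kind being part of the input. -/
structure Library.Realizer (𝓛 : Library) where
  mng : Data → Data
  upd : Data → Data
  trig : Data → Data
  polyTime_mng : PolyTimeWith ∅ mng
  polyTime_upd : PolyTimeWith ∅ upd
  polyTime_trig : PolyTimeWith ∅ trig
  mng_spec : ∀ (k : Fin 𝓛.K) (H : List OpStmt) (d : Data), (∀ h ∈ H, h ∈ (𝓛.kind k).opStmts) →
    d.toFinset ∈ (𝓛.kind k).KB →
    (mng (.node (.ofNat k) (.node (.ofList (H.map OpStmt.enc)) d))).toFinset =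
      (𝓛.kind k).mng H.toFinset d.toFinset
  upd_spec : ∀ (k : Fin 𝓛.K) (d a : Data), d.toFinset ∈ (𝓛.kind k).KB →
    (∀ e ∈ a.toList, e ∈ (𝓛.kind k).act) →
    ((upd (.node (.ofNat k) (.node d a))).toList.map Data.toFinset).toFinset =
      (𝓛.kind k).upd d.toFinset a.toFinset
  trig_spec : ∀ (k : Fin 𝓛.K) (T : ℕ) (H : List OpStmt) (d : Data),
    (∀ h ∈ H, h ∈ (𝓛.kind k).opStmts) → d.toFinset ∈ (𝓛.kind k).KB →
    (trig (.node (.ofNat k) (.node (.ofNat T) (.node (.ofList (H.map OpStmt.enc)) d)))).toFinset =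
      ((𝓛.kind k).trig T H.toFinset d.toFinset).image OpStmt.enc

theorem Library.IsPolyTime.nonempty_realizer {𝓛 : Library} (h : 𝓛.IsPolyTime) :
    Nonempty 𝓛.Realizer := by
  choose m hm hm' using fun k => (h k).1
  choose u hu hu' using fun k => (h k).2.1
  choose t ht ht' using fun k => (h k).2.2
  obtain ⟨M, hM, hM'⟩ := exists_polyTimeWith_dispatch m hm
  obtain ⟨U, hU, hU'⟩ := exists_polyTimeWith_dispatch u hu
  obtain ⟨T, hT, hT'⟩ := exists_polyTimeWith_dispatch t ht
  refine ⟨⟨M, U, T, hM, hU, hT, fun k H d h1 h2 => ?_, fun k d a h1 h2 => ?_,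
    fun k τ H d h1 h2 => ?_⟩⟩
  · have := hm' k H d.toList h1 h2
    rw [ofList_toList] at this
    rwa [hM']
  · have := hu' k d.toList a.toList h1 h2
    rw [ofList_toList, ofList_toList] at this
    rwa [hU']
  · have := ht' k τ H d.toList h1 h2
    rw [ofList_toList] at this
    rwa [hT']

/-! Nondeterministic verification of runs. An instance is given by its code `x`; a certificate `w`
is a pair of the length of a run and of a table, whose entry for time `T` and context `i` consists
of a knowledge base and of a projected belief set. -/

namespace Verifier

/-- These selectors follow the layout of `QueryInstance.enc`, and `kbAt`, `belAt` that of a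
certificate. Contexts and times are given by unary data. -/
def kindOf (x i : Data) : Data := (x.left.left.nth i).left.left

def kbOf (x i : Data) : Data := (x.left.left.nth i).left.right

def belOf (x i : Data) : Data := (x.left.left.nth i).right.left

def rulesOf (x i : Data) : Data := (x.left.left.nth i).right.right

def actOf (x T i : Data) : Data := (x.left.right.nth T).nth i

def headsOf (x i : Data) : Data := ofList ((rulesOf x i).toList.map Data.left)

def kbAt (w T i : Data) : Data := ((w.right.nth T).nth i).left

def belAt (w T i : Data) : Data := ((w.right.nth T).nth i).right

/-- The beliefs that occur in the query or in some bridge rule. -/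
def relevant (x : Data) : Data :=
  .node x.right.right (ofList (x.left.left.toList.flatMap fun c =>
    (ofList (c.right.right.toList.flatMap fun r =>
      (ofList ((ofList (r.right.left.toList ++ r.right.right.toList)).toList.map
        Data.right)).toList)).toList))

variable {𝓛 : Library} (F : 𝓛.Realizer)

/-- `Data.node .leaf T` codes the successor of `T`, so the range includes the time `T` itself. -/
def IsTriggered (x w T i h : Data) : Prop :=
  ∃ T' ∈ (Data.node .leaf T).range.toList,
    h ∈ (F.trig (.node (kindOf x i) (.node T' (.node (headsOf x i) (kbAt w T' i))))).toList

def BodyHolds (w T r : Data) : Prop :=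
  (∀ b ∈ r.right.left.toList, b.right ∈ (belAt w T b.left).toList) ∧
    ∀ b ∈ r.right.right.toList, ¬b.right ∈ (belAt w T b.left).toList

-- The coding and immediate decoding in the middle cancel; they give the expression the literal form
-- produced by `PolyTimeWith.map` and `PolyDec.filter`.
open Classical in
noncomputable def applicable (x w T i : Data) : Data :=
  ofList ((ofList ((rulesOf x i).toList.filter fun r =>
    decide (IsTriggered F x w T i r.left ∧ BodyHolds w T r))).toList.map Data.left)

/-- The possible updates are listed by a polynomial-time program, so none has to be guessed.
Knowledge bases are compared as sets, because the certificate may list them differently. The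
inclusion in the relevant beliefs makes the later queries instances of the context problem. -/
def StepOK (x w T i : Data) : Prop :=
  (∃ d ∈ (F.upd (.node (kindOf x i) (.node (kbAt w T i) (actOf x T i)))).toList,
    (kbAt w (.node .leaf T) i).toFinset =
      (F.mng (.node (kindOf x i) (.node (applicable F x w T i) d))).toFinset) ∧
  (belAt w (.node .leaf T) i).toList ⊆ (relevant x).toList

/-- The certificate describes a run, up to the acceptability of the belief sets, with answer `b`. -/
def Accepts (b : Prop) (x w : Data) : Prop :=
  -- The length is a successor `T + 1` with `T` below the number of action vectors, which expresses
  -- that it lies between 1 and that number.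
  (∃ T ∈ x.left.right.range.toList, w.left = .node .leaf T) ∧
  (∀ i ∈ x.left.left.range.toList, kbAt w .leaf i = kbOf x i ∧ belAt w .leaf i = belOf x i) ∧
  (∀ T ∈ w.left.range.toList, ∀ i ∈ x.left.left.range.toList, StepOK F x w T i) ∧
  -- `b` is true for witnesses of the existential query and false for counterexamples to the
  -- universal one.
  (x.right.right ∈ (belAt w w.left x.right.left).toList ↔ b)

/-- The context problems to be solved. -/
noncomputable def contextQueries (x w : Data) : Data :=
  ofList (w.left.range.toList.flatMap fun T =>
    (ofList (x.left.left.range.toList.map fun i =>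
      .node (kindOf x i) (.node
        (.node (applicable F x w (.node .leaf T) i) (kbAt w (.node .leaf T) i))
        (.node (relevant x) (belAt w (.node .leaf T) i))))).toList)

/-! ### Polynomial-time computability of the verifier -/

section PolyTime

variable {x w T i : Data → Data}

theorem polyTime_kindOf (hx : PolyTimeWith ∅ x) (hi : PolyTimeWith ∅ i) :
    PolyTimeWith ∅ fun z => kindOf (x z) (i z) := (hx.left.left.nth hi).left.left

theorem polyTime_kbOf (hx : PolyTimeWith ∅ x) (hi : PolyTimeWith ∅ i) :
    PolyTimeWith ∅ fun z => kbOf (x z) (i z) := (hx.left.left.nth hi).left.right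

theorem polyTime_belOf (hx : PolyTimeWith ∅ x) (hi : PolyTimeWith ∅ i) :
    PolyTimeWith ∅ fun z => belOf (x z) (i z) := (hx.left.left.nth hi).right.left

theorem polyTime_rulesOf (hx : PolyTimeWith ∅ x) (hi : PolyTimeWith ∅ i) :
    PolyTimeWith ∅ fun z => rulesOf (x z) (i z) := (hx.left.left.nth hi).right.right

theorem polyTime_actOf (hx : PolyTimeWith ∅ x) (hT : PolyTimeWith ∅ T) (hi : PolyTimeWith ∅ i) :
    PolyTimeWith ∅ fun z => actOf (x z) (T z) (i z) := (hx.left.right.nth hT).nth hi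

theorem polyTime_headsOf (hx : PolyTimeWith ∅ x) (hi : PolyTimeWith ∅ i) :
    PolyTimeWith ∅ fun z => headsOf (x z) (i z) :=
  (polyTime_rulesOf hx hi).map (F := fun _ a => a.left) PolyTimeWith.id.right.left

theorem polyTime_kbAt (hw : PolyTimeWith ∅ w) (hT : PolyTimeWith ∅ T) (hi : PolyTimeWith ∅ i) :
    PolyTimeWith ∅ fun z => kbAt (w z) (T z) (i z) := ((hw.right.nth hT).nth hi).left

theorem polyTime_belAt (hw : PolyTimeWith ∅ w) (hT : PolyTimeWith ∅ T) (hi : PolyTimeWith ∅ i) :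
    PolyTimeWith ∅ fun z => belAt (w z) (T z) (i z) := ((hw.right.nth hT).nth hi).right

theorem polyTime_relevant : PolyTimeWith ∅ relevant := by
  have id := PolyTimeWith.id (A := ∅)
  refine id.right.right.node (id.left.left.flatMap (F := fun _ c => _)
    (id.right.right.right.flatMap (F := fun _ r => _) ?_))
  exact (id.right.right.left.append id.right.right.right).map (F := fun _ a => a.right)
    id.right.right

theorem polyDec_isTriggered :
    PolyDec ∅ fun z => IsTriggered F z.left.left z.left.right z.right.left z.right.right.left
      z.right.right.right := by
  have id := PolyTimeWith.id (A := ∅)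
  refine PolyDec.exists_mem (p := fun z T' => z.right.right.right ∈ (F.trig (.node
    (kindOf z.left.left z.right.right.left) (.node T' (.node
      (headsOf z.left.left z.right.right.left)
      (kbAt z.left.right T' z.right.right.left))))).toList)
    ((PolyTimeWith.const _).node id.right.left).range (PolyDec.mem id.left.right.right.right ?_)
  have hi := id.left.right.right.left
  have hx := id.left.left.left
  exact F.polyTime_trig.comp ((polyTime_kindOf hx hi).node (id.right.node
    ((polyTime_headsOf hx hi).node (polyTime_kbAt id.left.left.right id.right hi))))

theorem polyDec_bodyHolds : PolyDec ∅ fun z => BodyHolds z.left z.right.left z.right.right := by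
  have id := PolyTimeWith.id (A := ∅)
  have h : PolyDec ∅ fun z => z.right.right ∈
      (belAt z.left.left z.left.right.left z.right.left).toList :=
    PolyDec.mem id.right.right (polyTime_belAt id.left.left id.left.right.left id.right.left)
  exact (PolyDec.forall_mem (p := fun z b => b.right ∈ (belAt z.left z.right.left b.left).toList)
    id.right.right.right.left h).and
    (PolyDec.forall_mem (p := fun z b => ¬b.right ∈ (belAt z.left z.right.left b.left).toList)
      id.right.right.right.right h.not)

theorem polyTime_applicable (hx : PolyTimeWith ∅ x) (hw : PolyTimeWith ∅ w)
    (hT : PolyTimeWith ∅ T) (hi : PolyTimeWith ∅ i) :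
    PolyTimeWith ∅ fun z => applicable F (x z) (w z) (T z) (i z) := by
  classical
  have id := PolyTimeWith.id (A := ∅)
  refine PolyTimeWith.map (F := fun _ r => r.left) ?_ id.right.left
  refine PolyDec.filter (p := fun z r =>
    IsTriggered F (x z) (w z) (T z) (i z) r.left ∧ BodyHolds (w z) (T z) r)
    (polyTime_rulesOf hx hi) (PolyDec.and ?_ ?_)
  · exact (polyDec_isTriggered F).comp (((hx.comp id.left).node (hw.comp id.left)).node
      ((hT.comp id.left).node ((hi.comp id.left).node id.right.left)))
  · exact polyDec_bodyHolds.comp ((hw.comp id.left).node ((hT.comp id.left).node id.right))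

theorem polyDec_stepOK (hx : PolyTimeWith ∅ x) (hw : PolyTimeWith ∅ w)
    (hT : PolyTimeWith ∅ T) (hi : PolyTimeWith ∅ i) :
    PolyDec ∅ fun z => StepOK F (x z) (w z) (T z) (i z) := by
  have id := PolyTimeWith.id (A := ∅)
  have hT' : PolyTimeWith ∅ fun z => Data.node .leaf (T z) := (PolyTimeWith.const _).node hT
  refine PolyDec.and (PolyDec.exists_mem (p := fun z d =>
    (kbAt (w z) (.node .leaf (T z)) (i z)).toFinset = (F.mng (.node (kindOf (x z) (i z)) (.node
      (applicable F (x z) (w z) (T z) (i z)) d))).toFinset) ?_ ?_)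
    (PolyDec.subset (polyTime_belAt hw hT' hi) (polyTime_relevant.comp hx))
  · exact F.polyTime_upd.comp ((polyTime_kindOf hx hi).node
      ((polyTime_kbAt hw hT hi).node (polyTime_actOf hx hT hi)))
  · refine PolyDec.toFinset_eq ((polyTime_kbAt hw hT' hi).comp id.left) (F.polyTime_mng.comp ?_)
    exact ((polyTime_kindOf hx hi).comp id.left).node
      (((polyTime_applicable F hx hw hT hi).comp id.left).node id.right)

theorem polyDec_accepts (b : Prop) : PolyDec ∅ fun z => Accepts F b z.left z.right := by
  have id := PolyTimeWith.id (A := ∅)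
  refine PolyDec.and ?_ (PolyDec.and ?_ (PolyDec.and ?_ ?_))
  · exact PolyDec.exists_mem (p := fun z T => z.right.left = .node .leaf T) id.left.left.right.range
      (PolyDec.eq id.left.right.left ((PolyTimeWith.const _).node id.right))
  · refine PolyDec.forall_mem (p := fun z i => kbAt z.right .leaf i = kbOf z.left i ∧
      belAt z.right .leaf i = belOf z.left i) id.left.left.left.range (PolyDec.and
      (PolyDec.eq (polyTime_kbAt id.left.right (PolyTimeWith.const _) id.right)
        (polyTime_kbOf id.left.left id.right))
      (PolyDec.eq (polyTime_belAt id.left.right (PolyTimeWith.const _) id.right)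
        (polyTime_belOf id.left.left id.right)))
  · refine PolyDec.forall_mem (p := fun z T => ∀ i ∈ z.left.left.left.range.toList,
      StepOK F z.left z.right T i) id.right.left.range ?_
    exact PolyDec.forall_mem (p := fun z i => StepOK F z.left.left z.left.right z.right i)
      id.left.left.left.left.range
      (polyDec_stepOK F id.left.left.left id.left.left.right id.left.right id.right)
  · have h : PolyDec ∅ fun z => z.left.right.right ∈
        (belAt z.right z.right.left z.left.right.left).toList :=
      PolyDec.mem id.left.right.right
        (polyTime_belAt id.right id.right.left id.left.right.left)
    by_cases hb : b
    · exact h.congr fun z => by simp [hb]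
    · exact h.not.congr fun z => by simp [hb]

theorem polyTime_contextQueries : PolyTimeWith ∅ fun z => contextQueries F z.left z.right := by
  have id := PolyTimeWith.id (A := ∅)
  refine id.right.left.range.flatMap (F := fun z T => ofList (z.left.left.left.range.toList.map
    fun i => .node (kindOf z.left i) (.node
        (.node (applicable F z.left z.right (.node .leaf T) i) (kbAt z.right (.node .leaf T) i))
        (.node (relevant z.left) (belAt z.right (.node .leaf T) i))))) ?_
  refine id.left.left.left.left.range.map (F := fun z i => .node (kindOf z.left.left i) (.node
        (.node (applicable F z.left.left z.left.right (.node .leaf z.right) i)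
          (kbAt z.left.right (.node .leaf z.right) i))
        (.node (relevant z.left.left) (belAt z.left.right (.node .leaf z.right) i)))) ?_
  have hx := id.left.left.left
  have hw := id.left.left.right
  have hT : PolyTimeWith ∅ fun z => Data.node .leaf z.left.right :=
    (PolyTimeWith.const _).node id.left.right
  exact (polyTime_kindOf hx id.right).node (((polyTime_applicable F hx hw hT id.right).node
    (polyTime_kbAt hw hT id.right)).node ((polyTime_relevant.comp hx).node
      (polyTime_belAt hw hT id.right)))

open Classical in
/-- The reduction: rejection, or a list of context problems. -/
noncomputable def reduction (b : Prop) (z : Data) : Data :=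
  if Accepts F b z.left z.right then .node .leaf (contextQueries F z.left z.right) else .leaf

open Classical in
theorem polyTime_reduction (b : Prop) : PolyTimeWith ∅ (reduction F b) :=
  (polyDec_accepts F b).ite ((PolyTimeWith.const _).node (polyTime_contextQueries F))
    (PolyTimeWith.const _)

end PolyTime
end Verifier

theorem join_node_ofNat {K : ℕ} {A : Fin K → Set Data} {k : Fin K} {y : Data} :
    Data.node (.ofNat k) y ∈ join A ↔ y ∈ A k := by
  constructor
  · rintro ⟨j, z, e, hz⟩
    simp only [Data.node.injEq] at e
    obtain ⟨e1, rfl⟩ := e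
    rwa [Fin.ext (ofNat_injective e1)]
  · exact fun h => ⟨k, y, rfl, h⟩

/-! ### Context problems and admissible data along runs -/

namespace ContextKind

theorem encContextInstance_injective {H H' : List OpStmt} {kb kb' R R' P P' : List Data}
    (h : encContextInstance H kb R P = encContextInstance H' kb' R' P') :
    H = H' ∧ kb = kb' ∧ R = R' ∧ P = P' := by
  simp only [encContextInstance, Data.node.injEq] at h
  obtain ⟨⟨h1, h2⟩, h3, h4⟩ := h
  exact ⟨OpStmt.enc_injective.list_map (ofList_injective h1), ofList_injective h2,
    ofList_injective h3, ofList_injective h4⟩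

/-- The code determines its four components, so the existential quantifiers in the set of positive
instances can only be met by the given data. -/
theorem mem_contextProblem_yes {C : ContextKind} {H : List OpStmt} {d R P : Data}
    (hH : ∀ h ∈ H, h ∈ C.opStmts) (hd : d.toFinset ∈ C.KB) (hP : P.toList ⊆ R.toList) :
    .node (.node (.ofList (H.map OpStmt.enc)) d) (.node R P) ∈ C.contextProblem.instances ∧
    (.node (.node (.ofList (H.map OpStmt.enc)) d) (.node R P) ∈ C.contextProblem.yes ↔
      ∃ S ∈ C.ACC (C.mng H.toFinset d.toFinset), S ∩ R.toFinset = P.toFinset) := by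
  have e : Data.node (.node (.ofList (H.map OpStmt.enc)) d) (.node R P) =
      encContextInstance H d.toList R.toList P.toList := by
    simp [encContextInstance]
  refine ⟨⟨H, d.toList, R.toList, P.toList, e, hH, hd, hP⟩, ?_, ?_⟩
  · rintro ⟨H', kb', R', P', e', -, -, -, h⟩
    obtain ⟨rfl, rfl, rfl, rfl⟩ := encContextInstance_injective (e.symm.trans e')
    exact h
  · exact fun h => ⟨H, d.toList, R.toList, P.toList, e, hH, hd, hP, h⟩

end ContextKind

theorem Library.mem_opStmts_of_mem_app {𝓛 : Library} {I : QueryInstance 𝓛.K} (hI : 𝓛.Valid I)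
    {kb S : ℕ → Fin I.sys.n → Finset Data} {T : ℕ} {i : Fin I.sys.n} {h : OpStmt}
    (hh : h ∈ 𝓛.app I.sys kb S T i) : h ∈ (𝓛.kind (I.sys.kind i)).opStmts := by
  simp only [app, List.mem_toFinset, List.mem_map, List.mem_filter] at hh
  obtain ⟨ρ, hρ, rfl⟩ := hh
  exact (hI i).2.2.1 ρ hρ.1

/-- The specifications of the programs and the instances of the context problem concern only members
of `KB`, so this invariant is needed before either can be used. -/
theorem Library.IsRun.mem_KB {𝓛 : Library} {I : QueryInstance 𝓛.K} (hI : 𝓛.Valid I) {t : ℕ}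
    {kb S : ℕ → Fin I.sys.n → Finset Data} (h : 𝓛.IsRun I.sys I.acts t kb S) :
    ∀ T ≤ t, ∀ i, kb T i ∈ (𝓛.kind (I.sys.kind i)).KB := by
  intro T
  induction T with
  | zero => intro _ i; rw [(h.1 i).1]; exact (hI i).1
  | succ T ih =>
    intro hT i
    obtain ⟨a, ha, hstep⟩ := h.2 T hT
    obtain ⟨⟨kb', hkb', e⟩, -⟩ := hstep i
    rw [e]
    refine ContextKind.mng_mem _ _ _ (ContextKind.upd_mem _ _ (ih (by omega) i) _ ?_ _ hkb')
      fun h hh => mem_opStmts_of_mem_app hI hh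
    intro e he
    exact (hI i).2.2.2 a (List.mem_of_getElem? ha) e (by simpa using he)

/-! ### Decoding of instances and soundness of certificates -/

namespace Verifier

section Decode

variable {K : ℕ} (I : QueryInstance K) (i : Fin I.sys.n)

theorem nth_enc : I.enc.left.left.nth (ofNat i) =
    .node (.node (.ofNat (I.sys.kind i)) (.ofList (I.sys.kb i)))
      (.node (.ofList (I.sys.bel i)) (.ofList ((I.sys.rules i).map BridgeRule.enc))) := by
  change (I.sys.enc).nth _ = _
  rw [System.enc, nth_ofList (by simp)]
  simp

theorem kindOf_enc : kindOf I.enc (ofNat i) = ofNat (I.sys.kind i) := by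
  rw [kindOf, nth_enc]; rfl

theorem kbOf_enc : kbOf I.enc (ofNat i) = ofList (I.sys.kb i) := by
  rw [kbOf, nth_enc]; rfl

theorem belOf_enc : belOf I.enc (ofNat i) = ofList (I.sys.bel i) := by
  rw [belOf, nth_enc]; rfl

theorem rulesOf_enc : rulesOf I.enc (ofNat i) = ofList ((I.sys.rules i).map BridgeRule.enc) := by
  rw [rulesOf, nth_enc]; rfl

theorem headsOf_enc : headsOf I.enc (ofNat i) =
    ofList (((I.sys.rules i).map BridgeRule.head).map OpStmt.enc) := by
  rw [headsOf, rulesOf_enc, toList_ofList, List.map_map, List.map_map]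
  rfl

theorem actOf_enc {T : ℕ} {a : Fin I.sys.n → List Data} (h : I.acts[T]? = some a) :
    actOf I.enc (ofNat T) (ofNat i) = ofList (a i) := by
  obtain ⟨hT, rfl⟩ := List.getElem?_eq_some_iff.1 h
  change ((ofList (I.acts.map _)).nth _).nth _ = _
  rw [nth_ofList (by simpa using hT), List.getElem_map, nth_ofList (by simp)]
  simp

theorem mem_range_sys {d : Data} : d ∈ I.enc.left.left.range.toList ↔
    ∃ i : Fin I.sys.n, d = ofNat i := by
  rw [mem_range]
  change (∃ k < I.sys.enc.toList.length, _) ↔ _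
  simp [System.enc, Fin.exists_iff]

theorem mem_range_acts {d : Data} : d ∈ I.enc.left.right.range.toList ↔
    ∃ k < I.acts.length, d = ofNat k := by
  rw [mem_range]
  change (∃ k < (ofList (I.acts.map _)).toList.length, _) ↔ _
  simp

theorem query_mem_relevant : I.query ∈ (relevant I.enc).toList := List.mem_cons_self

theorem mem_relevant {ρ : BridgeRule I.sys.n} (hρ : ρ ∈ I.sys.rules i) {b : Fin I.sys.n × Data}
    (hb : b ∈ ρ.pos ∨ b ∈ ρ.neg) : b.2 ∈ (relevant I.enc).toList := by
  refine List.mem_cons_of_mem _ ?_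
  change _ ∈ (ofList (I.sys.enc.toList.flatMap _)).toList
  simp only [toList_ofList, List.mem_flatMap]
  refine ⟨.node (.node (.ofNat (I.sys.kind i)) (.ofList (I.sys.kb i)))
    (.node (.ofList (I.sys.bel i)) (.ofList ((I.sys.rules i).map BridgeRule.enc))), ?_, ?_⟩
  · simp only [System.enc, toList_ofList, List.mem_ofFn']
    exact ⟨i, rfl⟩
  · refine ⟨ρ.enc, by simpa using ⟨ρ, hρ, rfl⟩, ?_⟩
    simp only [BridgeRule.enc, right_node, left_node, toList_ofList, List.mem_map, List.mem_append]
    refine ⟨.node (.ofNat b.1) b.2, hb.imp ?_ ?_, rfl⟩ <;> exact fun h => ⟨b, h, rfl⟩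

end Decode

variable {𝓛 : Library} (F : 𝓛.Realizer) (I : QueryInstance 𝓛.K) (w : Data)

open Classical in
/-- The applicable heads according to a certificate. -/
noncomputable def applicableHeads (T : ℕ) (i : Fin I.sys.n) : List OpStmt :=
  ((I.sys.rules i).filter fun ρ => decide (IsTriggered F I.enc w (ofNat T) (ofNat i) ρ.head.enc ∧
    BodyHolds w (ofNat T) ρ.enc)).map BridgeRule.head

theorem applicable_enc (T : ℕ) (i : Fin I.sys.n) :
    applicable F I.enc w (ofNat T) (ofNat i) =
      ofList ((applicableHeads F I w T i).map OpStmt.enc) := by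
  classical
  rw [applicable, rulesOf_enc, toList_ofList, toList_ofList, List.filter_map, applicableHeads,
    List.map_map, List.map_map]
  rfl

theorem mem_opStmts_of_mem_applicableHeads {I : QueryInstance 𝓛.K} (hI : 𝓛.Valid I) {T : ℕ}
    {i : Fin I.sys.n} : ∀ h ∈ applicableHeads F I w T i, h ∈ (𝓛.kind (I.sys.kind i)).opStmts := by
  intro h hh
  simp only [applicableHeads, List.mem_map, List.mem_filter] at hh
  obtain ⟨ρ, hρ, rfl⟩ := hh
  exact (hI i).2.2.1 ρ hρ.1

/-- The certificate agrees with the evolution `kb`, `S` up to time `t`, as far as the relevant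
beliefs are concerned. -/
def Agrees (t : ℕ) (kb S : ℕ → Fin I.sys.n → Finset Data) : Prop :=
  ∀ T ≤ t, ∀ i : Fin I.sys.n, (kbAt w (ofNat T) (ofNat i)).toFinset = kb T i ∧
    kb T i ∈ (𝓛.kind (I.sys.kind i)).KB ∧
    ∀ p ∈ (relevant I.enc).toList, p ∈ S T i ↔ p ∈ (belAt w (ofNat T) (ofNat i)).toList

variable {I w}

/-- Triggering reads only knowledge bases, and rule bodies read only relevant beliefs. An agreeing
certificate therefore gives both the same truth values as the full evolution does; this is why
projections are enough to guess. -/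
theorem toFinset_applicableHeads (hI : 𝓛.Valid I) {t : ℕ} {kb S : ℕ → Fin I.sys.n → Finset Data}
    (h : Agrees I w t kb S) {T : ℕ} (hT : T ≤ t) (i : Fin I.sys.n) :
    (applicableHeads F I w T i).toFinset = 𝓛.app I.sys kb S T i := by
  classical
  rw [applicableHeads, Library.app]
  congr 2
  refine List.filter_congr fun ρ hρ => decide_eq_decide.2 (and_congr ?_ ?_)
  · have key : ∀ T' ≤ T, ρ.head.enc ∈ (F.trig (.node (kindOf I.enc (ofNat i)) (.node (ofNat T')
        (.node (headsOf I.enc (ofNat i)) (kbAt w (ofNat T') (ofNat i)))))).toList ↔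
        𝓛.Triggered I.sys kb T' i ρ := by
      intro T' hT'
      obtain ⟨h1, h2, -⟩ := h T' (hT'.trans hT) i
      rw [← mem_toFinset, kindOf_enc, headsOf_enc, F.trig_spec, h1,
        OpStmt.enc_injective.mem_finset_image]
      · rfl
      · intro h hh
        obtain ⟨ρ', hρ', rfl⟩ := List.mem_map.1 hh
        exact (hI i).2.2.1 ρ' hρ'
      · rwa [h1]
    simp only [IsTriggered, mem_range]
    constructor
    · rintro ⟨_, ⟨k, hk, rfl⟩, hk'⟩
      have hk : k ≤ T := by simpa [Nat.lt_succ_iff] using hk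
      exact ⟨k, hk, (key k hk).1 hk'⟩
    · rintro ⟨k, hk, hk'⟩
      exact ⟨_, ⟨k, by simpa [Nat.lt_succ_iff] using hk, rfl⟩, (key k hk).2 hk'⟩
  · have key : ∀ b, b ∈ ρ.pos ∨ b ∈ ρ.neg → (b.2 ∈ (belAt w (ofNat T) (ofNat b.1)).toList ↔
        b.2 ∈ S T b.1) := fun b hb =>
      ((h T hT b.1).2.2 _ (mem_relevant I i hρ hb)).symm
    simp only [BodyHolds, BridgeRule.Holds, BridgeRule.enc, right_node, left_node, toList_ofList,
      List.forall_mem_map]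
    exact and_congr (forall₂_congr fun b hb => key b (.inl hb))
      (forall₂_congr fun b hb => not_congr (key b (.inr hb)))

variable {A : Fin 𝓛.K → Set Data}

/-- The languages `A k` are only known to be right on instances; `hKB` and `hP` ensure that the
query is one. -/
theorem mem_join_iff
    (hA : ∀ k, ∀ y ∈ (𝓛.kind k).contextProblem.instances,
      (y ∈ A k ↔ y ∈ (𝓛.kind k).contextProblem.yes))
    (hI : 𝓛.Valid I) {T : ℕ} {i : Fin I.sys.n}
    (hKB : (kbAt w (ofNat T) (ofNat i)).toFinset ∈ (𝓛.kind (I.sys.kind i)).KB)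
    (hP : (belAt w (ofNat T) (ofNat i)).toList ⊆ (relevant I.enc).toList) :
    Data.node (kindOf I.enc (ofNat i)) (.node
        (.node (applicable F I.enc w (ofNat T) (ofNat i)) (kbAt w (ofNat T) (ofNat i)))
        (.node (relevant I.enc) (belAt w (ofNat T) (ofNat i)))) ∈ join A ↔
      ∃ S ∈ (𝓛.kind (I.sys.kind i)).ACC ((𝓛.kind (I.sys.kind i)).mng
        (applicableHeads F I w T i).toFinset (kbAt w (ofNat T) (ofNat i)).toFinset),
        S ∩ (relevant I.enc).toFinset = (belAt w (ofNat T) (ofNat i)).toFinset := by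
  obtain ⟨h1, h2⟩ := ContextKind.mem_contextProblem_yes
    (mem_opStmts_of_mem_applicableHeads F w hI) hKB hP
  rw [kindOf_enc, applicable_enc, join_node_ofNat, hA _ _ h1, h2]

theorem stepOK_iff (hI : 𝓛.Valid I) {T : ℕ} {i : Fin I.sys.n} {a : Fin I.sys.n → List Data}
    (ha : I.acts[T]? = some a)
    (hKB : (kbAt w (ofNat T) (ofNat i)).toFinset ∈ (𝓛.kind (I.sys.kind i)).KB) :
    StepOK F I.enc w (ofNat T) (ofNat i) ↔
      (∃ kb' ∈ (𝓛.kind (I.sys.kind i)).upd (kbAt w (ofNat T) (ofNat i)).toFinset (a i).toFinset,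
        (kbAt w (ofNat (T + 1)) (ofNat i)).toFinset =
          (𝓛.kind (I.sys.kind i)).mng (applicableHeads F I w T i).toFinset kb') ∧
      (belAt w (ofNat (T + 1)) (ofNat i)).toList ⊆ (relevant I.enc).toList := by
  have hact : ∀ e ∈ a i, e ∈ (𝓛.kind (I.sys.kind i)).act :=
    (hI i).2.2.2 a (List.mem_of_getElem? ha)
  have hu := F.upd_spec (I.sys.kind i) (kbAt w (ofNat T) (ofNat i)) (ofList (a i)) hKB
    (by simpa using hact)
  have hmem : ∀ d ∈ (F.upd (.node (kindOf I.enc (ofNat i)) (.node (kbAt w (ofNat T) (ofNat i))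
      (actOf I.enc (ofNat T) (ofNat i))))).toList, d.toFinset ∈
        (𝓛.kind (I.sys.kind i)).upd (kbAt w (ofNat T) (ofNat i)).toFinset (a i).toFinset := by
    intro d hd
    rw [kindOf_enc, actOf_enc I i ha] at hd
    rw [toFinset_ofList] at hu
    rw [← hu]
    exact List.mem_toFinset.2 (List.mem_map_of_mem hd)
  have hm : ∀ d : Data, d.toFinset ∈
        (𝓛.kind (I.sys.kind i)).upd (kbAt w (ofNat T) (ofNat i)).toFinset (a i).toFinset →
      (F.mng (.node (kindOf I.enc (ofNat i))
        (.node (applicable F I.enc w (ofNat T) (ofNat i)) d))).toFinset =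
      (𝓛.kind (I.sys.kind i)).mng (applicableHeads F I w T i).toFinset d.toFinset := by
    intro d hd
    rw [kindOf_enc, applicable_enc, F.mng_spec _ _ _ (mem_opStmts_of_mem_applicableHeads F w hI)]
    exact ContextKind.upd_mem _ _ hKB _ (fun e he => hact e (by simpa using he)) _ hd
  refine and_congr ⟨?_, ?_⟩ Iff.rfl
  · rintro ⟨d, hd, e⟩
    exact ⟨d.toFinset, hmem d hd, e.trans (hm d (hmem d hd))⟩
  · rintro ⟨kb', hkb', e⟩
    have h := hkb'
    rw [toFinset_ofList] at hu
    rw [← hu, List.mem_toFinset, List.mem_map] at h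
    obtain ⟨d, hd, rfl⟩ := h
    rw [← kindOf_enc, ← actOf_enc I i ha] at hd
    exact ⟨d, hd, e.trans (hm d hkb').symm⟩

/-- Knowledge bases are read off the table, and each positive context query supplies an acceptable
belief set with the tabulated projection. These choices can be made independently for all contexts
and times, since they influence each other only through the applicable heads, which the projections
fix. -/
theorem sound {b : Prop}
    (hA : ∀ k, ∀ y ∈ (𝓛.kind k).contextProblem.instances,
      (y ∈ A k ↔ y ∈ (𝓛.kind k).contextProblem.yes))
    (hI : 𝓛.Valid I) (hacc : Accepts F b I.enc w)
    (hq : ∀ q ∈ (contextQueries F I.enc w).toList, q ∈ join A) :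
    ∃ t ≤ I.acts.length, ∃ E, 𝓛.IsTimedEquilibrium I.sys I.acts t E ∧
      (I.query ∈ E I.ctx ↔ b) := by
  obtain ⟨⟨_, hT0, hw⟩, h0, hstep, hfin⟩ := hacc
  obtain ⟨t, ht, rfl⟩ := (mem_range_acts I).1 hT0
  change w.left = ofNat (t + 1) at hw
  have hrange : ∀ T ≤ t, ofNat T ∈ w.left.range.toList := fun T hT =>
    mem_range.2 ⟨T, by rw [hw, length_toList_ofNat]; omega, rfl⟩
  set kb : ℕ → Fin I.sys.n → Finset Data := fun T i => (kbAt w (ofNat T) (ofNat i)).toFinset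
    with hkb
  have hsys : ∀ i : Fin I.sys.n, ofNat i ∈ I.enc.left.left.range.toList := fun i =>
    (mem_range_sys I).2 ⟨i, rfl⟩
  have hget : ∀ T ≤ t, ∃ a, I.acts[T]? = some a := fun T hT =>
    ⟨_, List.getElem?_eq_getElem (by omega)⟩
  have hinit : ∀ i, kb 0 i = (I.sys.kb i).toFinset := fun i => by
    have := (h0 _ (hsys i)).1
    rw [kbOf_enc] at this
    rw [← toFinset_ofList, ← this]; rfl
  have hKB : ∀ T ≤ t + 1, ∀ i, kb T i ∈ (𝓛.kind (I.sys.kind i)).KB := by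
    intro T
    induction T with
    | zero => intro _ i; rw [hinit]; exact (hI i).1
    | succ T ih =>
      intro hT i
      obtain ⟨a, ha⟩ := hget T (by omega)
      have hi := ih (by omega) i
      obtain ⟨⟨kb', hkb', e⟩, -⟩ := (stepOK_iff F hI ha hi).1
        (hstep _ (hrange T (by omega)) _ (hsys i))
      simp only [hkb]
      rw [e]
      refine ContextKind.mng_mem _ _ _ (ContextKind.upd_mem _ _ hi _ ?_ _ hkb') ?_
      · intro e he
        exact (hI i).2.2.2 a (List.mem_of_getElem? ha) e (by simpa using he)
      · intro h hh
        exact mem_opStmts_of_mem_applicableHeads F w hI h (by simpa using hh)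
  have hsub : ∀ T ≤ t, ∀ i : Fin I.sys.n,
      (belAt w (ofNat (T + 1)) (ofNat i)).toList ⊆ (relevant I.enc).toList := fun T hT i =>
    (hstep _ (hrange T hT) _ (hsys i)).2
  -- Acceptability is not demanded of the initial belief set, which is taken as given; after the end
  -- of the run the value is arbitrary.
  have hS : ∀ (T : ℕ) (i : Fin I.sys.n), ∃ S : Finset Data,
      (T = 0 → S = (I.sys.bel i).toFinset) ∧ (0 < T → T ≤ t + 1 →
        S ∈ (𝓛.kind (I.sys.kind i)).ACC ((𝓛.kind (I.sys.kind i)).mng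
          (applicableHeads F I w T i).toFinset (kb T i)) ∧
        S ∩ (relevant I.enc).toFinset = (belAt w (ofNat T) (ofNat i)).toFinset) := by
    intro T i
    rcases T with _ | T
    · exact ⟨_, fun _ => rfl, by simp⟩
    · by_cases hT : T ≤ t
      · obtain ⟨S, h1, h2⟩ := (mem_join_iff F hA hI (hKB (T + 1) (by omega) i) (hsub T hT i)).1 (by
          refine hq _ ?_
          simp only [contextQueries, toList_ofList, List.mem_flatMap, List.mem_map]
          exact ⟨ofNat T, hrange T hT, ofNat i, hsys i, rfl⟩)
        exact ⟨S, by simp, fun _ _ => ⟨h1, h2⟩⟩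
      · exact ⟨∅, by simp, fun _ h => absurd h (by omega)⟩
  choose S hS0 hS1 using hS
  have hag : Agrees I w (t + 1) kb S := by
    refine fun T hT i => ⟨rfl, hKB T hT i, fun p hp => ?_⟩
    rcases T with _ | T
    · have := (h0 _ (hsys i)).2
      rw [belOf_enc] at this
      change _ ↔ p ∈ (belAt w .leaf (ofNat i)).toList
      rw [hS0 0 i rfl, this]
      simp
    · rw [← mem_toFinset, ← (hS1 (T + 1) i (by omega) hT).2, Finset.mem_inter]
      exact ⟨fun h => ⟨h, mem_toFinset.2 hp⟩, fun h => h.1⟩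
  refine ⟨t + 1, ht, S (t + 1), ⟨by omega, kb, S, ⟨fun i => ⟨hinit i, hS0 0 i rfl⟩, ?_⟩, rfl⟩, ?_⟩
  · intro T hT
    obtain ⟨a, ha⟩ := hget T (by omega)
    refine ⟨a, ha, fun i => ⟨?_, ?_⟩⟩
    · rw [← toFinset_applicableHeads F hI hag hT.le]
      exact ((stepOK_iff F hI ha (hKB T hT.le i)).1 (hstep _ (hrange T (by omega)) _ (hsys i))).1
    · rw [← toFinset_applicableHeads F hI hag hT]
      exact (hS1 (T + 1) i (by omega) hT).1
  · rw [← hfin, hw]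
    exact (hag (t + 1) le_rfl I.ctx).2.2 _ (query_mem_relevant I)

end Verifier

/-! ### Size of certificates and completeness -/

namespace Verifier

theorem size_kindOf_le (x i : Data) : (kindOf x i).size ≤ x.size :=
  (size_left_le _).trans <| (size_left_le _).trans <| (size_nth_le _ _).trans <|
    (size_left_le _).trans (size_left_le _)

theorem size_kbOf_le (x i : Data) : (kbOf x i).size ≤ x.size :=
  (size_right_le _).trans <| (size_left_le _).trans <| (size_nth_le _ _).trans <|
    (size_left_le _).trans (size_left_le _)

theorem size_belOf_le (x i : Data) : (belOf x i).size ≤ x.size :=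
  (size_left_le _).trans <| (size_right_le _).trans <| (size_nth_le _ _).trans <|
    (size_left_le _).trans (size_left_le _)

theorem size_headsOf_le (x i : Data) : (headsOf x i).size ≤ x.size := by
  refine (size_ofList_map_left_le _).trans ?_
  rw [ofList_toList]
  exact (size_right_le _).trans <| (size_right_le _).trans <| (size_nth_le _ _).trans <|
    (size_left_le _).trans (size_left_le _)

theorem size_actOf_le (x T i : Data) : (actOf x T i).size ≤ x.size :=
  (size_nth_le _ _).trans <| (size_nth_le _ _).trans <|
    (size_right_le _).trans (size_left_le _)

theorem n_lt_size {K : ℕ} (I : QueryInstance K) : I.sys.n < I.enc.size := by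
  have h : I.enc.left.left.toList.length = I.sys.n := by
    change I.sys.enc.toList.length = _
    simp [System.enc]
  exact h ▸ (length_toList_lt _).trans_le ((size_left_le _).trans (size_left_le _))

theorem length_acts_lt_size {K : ℕ} (I : QueryInstance K) : I.acts.length < I.enc.size := by
  have h : I.enc.left.right.toList.length = I.acts.length := by
    change (ofList (I.acts.map _)).toList.length = _
    simp
  exact h ▸ (length_toList_lt _).trans_le ((size_right_le _).trans (size_left_le _))

/-- The certificate that describes an evolution up to time `t`. -/
noncomputable def certificate {K : ℕ} (I : QueryInstance K) (t : ℕ)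
    (kb S : ℕ → Fin I.sys.n → Finset Data) : Data :=
  .node (.ofNat t) (ofList ((List.range (t + 1)).map fun T => ofList (List.ofFn fun i =>
    -- At time 0 the lists of the instance are copied verbatim and without projection, because
    -- `Accepts` compares data there and not sets.
    if T = 0 then .node (ofList (I.sys.kb i)) (ofList (I.sys.bel i))
    else .node (ofList (kb T i).toList)
      (ofList ((relevant I.enc).toList.filter fun p => decide (p ∈ S T i))))))

section

variable {K : ℕ} (I : QueryInstance K) (t : ℕ) (kb S : ℕ → Fin I.sys.n → Finset Data)

theorem nth_certificate {T : ℕ} (hT : T ≤ t) (i : Fin I.sys.n) :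
    ((certificate I t kb S).right.nth (ofNat T)).nth (ofNat i) =
      if T = 0 then .node (ofList (I.sys.kb i)) (ofList (I.sys.bel i))
      else .node (ofList (kb T i).toList)
        (ofList ((relevant I.enc).toList.filter fun p => decide (p ∈ S T i))) := by
  rw [certificate, right_node, nth_ofList (by simpa using Nat.lt_succ_of_le hT), List.getElem_map,
    nth_ofList (by simp)]
  simp

theorem kbAt_certificate_zero (i : Fin I.sys.n) :
    kbAt (certificate I t kb S) .leaf (ofNat i) = ofList (I.sys.kb i) := by
  have := nth_certificate I t kb S (Nat.zero_le _) i
  rw [kbAt]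
  simp only [ofNat] at this
  rw [this]; rfl

theorem belAt_certificate_zero (i : Fin I.sys.n) :
    belAt (certificate I t kb S) .leaf (ofNat i) = ofList (I.sys.bel i) := by
  have := nth_certificate I t kb S (Nat.zero_le _) i
  rw [belAt]
  simp only [ofNat] at this
  rw [this]; rfl

theorem kbAt_certificate_succ {T : ℕ} (hT : T + 1 ≤ t) (i : Fin I.sys.n) :
    kbAt (certificate I t kb S) (ofNat (T + 1)) (ofNat i) = ofList (kb (T + 1) i).toList := by
  rw [kbAt, nth_certificate I t kb S hT]; rfl

theorem belAt_certificate_succ {T : ℕ} (hT : T + 1 ≤ t) (i : Fin I.sys.n) :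
    belAt (certificate I t kb S) (ofNat (T + 1)) (ofNat i) =
      ofList ((relevant I.enc).toList.filter fun p => decide (p ∈ S (T + 1) i)) := by
  rw [belAt, nth_certificate I t kb S hT]; rfl

/-- Rows and columns are fewer than the size of the instance allows. A cell consists of parts of the
instance, or of a knowledge base and a sublist of the relevant beliefs; only the bound `B` for the
knowledge bases has to come from elsewhere. -/
theorem size_certificate_le (ht : t ≤ I.acts.length) {B : ℕ}
    (hB : ∀ T ≤ t, ∀ i, ∑ s ∈ kb T i, (s.size + 1) ≤ B) :
    (certificate I t kb S).size ≤ 2 * I.enc.size + 3 + I.enc.size * (2 + I.enc.size *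
      (2 * I.enc.size + B + (relevant I.enc).size + 3)) := by
  have h1 := n_lt_size I
  have h2 := length_acts_lt_size I
  have hrow : ∀ T ≤ t, (ofList (List.ofFn fun i : Fin I.sys.n =>
      if T = 0 then Data.node (ofList (I.sys.kb i)) (ofList (I.sys.bel i))
      else .node (ofList (kb T i).toList)
        (ofList ((relevant I.enc).toList.filter fun p => decide (p ∈ S T i))))).size ≤
      1 + I.enc.size * (2 * I.enc.size + B + (relevant I.enc).size + 3) := by
    intro T hT
    refine (size_ofList_le (B := 2 * I.enc.size + B + (relevant I.enc).size + 2) ?_).trans ?_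
    · intro a ha
      obtain ⟨i, rfl⟩ := (List.mem_ofFn' _ _).1 ha
      have h3 := size_kbOf_le I.enc (ofNat i)
      have h4 := size_belOf_le I.enc (ofNat i)
      rw [kbOf_enc] at h3
      rw [belOf_enc] at h4
      have h5 := hB T hT i
      have h6 := size_ofList_finset (kb T i)
      have h7 := size_ofList_sublist
        (List.filter_sublist (p := fun p => decide (p ∈ S T i)) (l := (relevant I.enc).toList))
      rw [ofList_toList] at h7
      split_ifs <;> simp only [size] <;> omega
    · rw [List.length_ofFn]
      gcongr
  have htab := size_ofList_le (l := (List.range (t + 1)).map fun T => ofList (List.ofFn fun i =>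
    if T = 0 then Data.node (ofList (I.sys.kb i)) (ofList (I.sys.bel i))
    else .node (ofList (kb T i).toList)
      (ofList ((relevant I.enc).toList.filter fun p => decide (p ∈ S T i)))))
    (B := 1 + I.enc.size * (2 * I.enc.size + B + (relevant I.enc).size + 3)) (by
      intro a ha
      obtain ⟨T, hT, rfl⟩ := List.mem_map.1 ha
      exact hrow T (by simpa [Nat.lt_succ_iff] using hT))
  rw [List.length_map, List.length_range] at htab
  have h3 : (t + 1) * (1 + I.enc.size * (2 * I.enc.size + B + (relevant I.enc).size + 3) + 1) ≤
      I.enc.size * (2 + I.enc.size * (2 * I.enc.size + B + (relevant I.enc).size + 3)) := by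
    refine Nat.mul_le_mul (by omega) (by omega)
  rw [certificate]
  simp only [size, size_ofNat]
  omega

end

variable {𝓛 : Library} (F : 𝓛.Realizer) {I : QueryInstance 𝓛.K} {A : Fin 𝓛.K → Set Data}

/-- The certificate built from a run agrees with it, so each check reduces to the corresponding
clause of the run. Each context query is witnessed by the belief set of the run itself. -/
theorem complete {b : Prop}
    (hA : ∀ k, ∀ y ∈ (𝓛.kind k).contextProblem.instances,
      (y ∈ A k ↔ y ∈ (𝓛.kind k).contextProblem.yes))
    (hI : 𝓛.Valid I) {t : ℕ} (ht : 1 ≤ t) (ht' : t ≤ I.acts.length)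
    {kb S : ℕ → Fin I.sys.n → Finset Data} (hrun : 𝓛.IsRun I.sys I.acts t kb S)
    (hb : I.query ∈ S t I.ctx ↔ b) :
    Accepts F b I.enc (certificate I t kb S) ∧
      ∀ q ∈ (contextQueries F I.enc (certificate I t kb S)).toList, q ∈ join A := by
  set w := certificate I t kb S with hw
  have hKB := hrun.mem_KB hI
  have hag : Agrees I w t kb S := by
    refine fun T hT i => ⟨?_, hKB T hT i, fun p hp => ?_⟩
    · rcases T with _ | T
      · change (kbAt w .leaf _).toFinset = _
        rw [hw, kbAt_certificate_zero, toFinset_ofList, (hrun.1 i).1]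
      · rw [hw, kbAt_certificate_succ I t kb S hT, toFinset_ofList, Finset.toList_toFinset]
    · rcases T with _ | T
      · change _ ↔ p ∈ (belAt w .leaf _).toList
        rw [hw, belAt_certificate_zero, (hrun.1 i).2, toList_ofList, List.mem_toFinset]
      · rw [hw, belAt_certificate_succ I t kb S hT]
        simp [hp]
  have happ := fun {T : ℕ} (hT : T ≤ t) i => toFinset_applicableHeads F hI hag hT i
  have hsub : ∀ T, T + 1 ≤ t → ∀ i : Fin I.sys.n,
      (belAt w (ofNat (T + 1)) (ofNat i)).toList ⊆ (relevant I.enc).toList := by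
    intro T hT i
    rw [hw, belAt_certificate_succ I t kb S hT, toList_ofList]
    exact List.filter_sublist.subset
  have hrange : ∀ d ∈ w.left.range.toList, ∃ T < t, d = ofNat T := by
    intro d hd
    simpa [hw, certificate, mem_range] using hd
  refine ⟨⟨?_, ?_, ?_, ?_⟩, ?_⟩
  · obtain ⟨t, rfl⟩ : ∃ s, t = s + 1 := ⟨t - 1, by omega⟩
    exact ⟨ofNat t, (mem_range_acts I).2 ⟨t, ht', rfl⟩, rfl⟩
  · intro d hd
    obtain ⟨i, rfl⟩ := (mem_range_sys I).1 hd
    rw [kbOf_enc, belOf_enc]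
    exact ⟨kbAt_certificate_zero I t kb S i, belAt_certificate_zero I t kb S i⟩
  · intro d hd e he
    obtain ⟨T, hT, rfl⟩ := hrange d hd
    obtain ⟨i, rfl⟩ := (mem_range_sys I).1 he
    obtain ⟨a, ha, hstep⟩ := hrun.2 T hT
    have h1 := (hag T hT.le i).1
    rw [stepOK_iff F hI ha (by rw [h1]; exact hKB T hT.le i), h1, (hag (T + 1) hT i).1, happ hT.le]
    exact ⟨(hstep i).1, hsub T hT i⟩
  · rw [← hb]
    exact ((hag t le_rfl I.ctx).2.2 _ (query_mem_relevant I)).symm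
  · intro q hq
    simp only [contextQueries, toList_ofList, List.mem_flatMap, List.mem_map] at hq
    obtain ⟨d, hd, e, he, rfl⟩ := hq
    obtain ⟨T, hT, rfl⟩ := hrange d hd
    obtain ⟨i, rfl⟩ := (mem_range_sys I).1 he
    obtain ⟨a, ha, hstep⟩ := hrun.2 T hT
    have h1 := (hag (T + 1) hT i).1
    refine (mem_join_iff F hA hI (T := T + 1) (by rw [h1]; exact hKB (T + 1) hT i)
      (hsub T hT i)).2 ⟨S (T + 1) i, ?_, ?_⟩
    · rw [h1, happ hT]
      exact (hstep i).2
    · ext p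
      rw [Finset.mem_inter, mem_toFinset, mem_toFinset]
      constructor
      · exact fun h => ((hag (T + 1) hT i).2.2 p h.2).1 h.1
      · exact fun h => ⟨((hag (T + 1) hT i).2.2 p (hsub T hT i h)).2 h, hsub T hT i h⟩

end Verifier

/-! ### Growth of knowledge bases and membership -/

namespace Library

open Verifier

variable {𝓛 : Library}

/-- Updates and management are outputs of polynomial-time programs, and a listed set is no larger
than its list. `H` has to come from a sublist of the rule heads, so that its code is bounded by the
instance. -/
theorem sum_mng_le (F : 𝓛.Realizer) : ∃ P : Polynomial ℕ, ∀ I : QueryInstance 𝓛.K, 𝓛.Valid I →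
    ∀ (i : Fin I.sys.n) (H : Finset OpStmt) (kb kb' : Finset Data) (T : ℕ)
      (a : Fin I.sys.n → List Data),
    (∃ L : List OpStmt, L.Sublist ((I.sys.rules i).map BridgeRule.head) ∧ L.toFinset = H) →
    kb ∈ (𝓛.kind (I.sys.kind i)).KB → I.acts[T]? = some a →
    kb' ∈ (𝓛.kind (I.sys.kind i)).upd kb (a i).toFinset →
    ∑ s ∈ (𝓛.kind (I.sys.kind i)).mng H kb', (s.size + 1) ≤
      P.eval (I.enc.size + ∑ s ∈ kb, (s.size + 1)) := by
  obtain ⟨qm, hm⟩ := F.polyTime_mng.size_le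
  obtain ⟨qu, hu⟩ := F.polyTime_upd.size_le
  -- `2 * X + 3` bounds the input of the update program (kind, knowledge base, action), and `qu` of
  -- it any listed update; together with kind and heads this bounds the input of the management
  -- program.
  refine ⟨qm.comp (2 * .X + qu.comp (2 * .X + 3) + 2), ?_⟩
  rintro I hI i H kb kb' T a ⟨L, hL, rfl⟩ hkb ha hkb'
  have hact : ∀ e ∈ a i, e ∈ (𝓛.kind (I.sys.kind i)).act :=
    (hI i).2.2.2 a (List.mem_of_getElem? ha)
  have hk := kindOf_enc I i ▸ size_kindOf_le I.enc (ofNat i)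
  have hac := actOf_enc I i ha ▸ size_actOf_le I.enc (ofNat T) (ofNat i)
  have hh := headsOf_enc I i ▸ size_headsOf_le I.enc (ofNat i)
  have hL' := size_ofList_sublist (hL.map OpStmt.enc)
  have hs := size_ofList_finset kb
  have hus := F.upd_spec (I.sys.kind i) (ofList kb.toList) (ofList (a i)) (by simpa using hkb)
    (by simpa using hact)
  simp only [toFinset_ofList, Finset.toList_toFinset] at hus
  rw [← hus, List.mem_toFinset, List.mem_map] at hkb'
  obtain ⟨d, hd, rfl⟩ := hkb'
  have hdKB : d.toFinset ∈ (𝓛.kind (I.sys.kind i)).KB := by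
    refine ContextKind.upd_mem _ _ hkb (a i).toFinset (fun e he => hact e (by simpa using he)) _ ?_
    rw [← hus]
    exact List.mem_toFinset.2 (List.mem_map_of_mem hd)
  have hms := F.mng_spec (I.sys.kind i) L d (fun h hh => by
    obtain ⟨ρ, hρ, rfl⟩ := List.mem_map.1 (hL.subset hh)
    exact (hI i).2.2.1 ρ hρ) hdKB
  rw [← hms]
  refine (sum_toFinset_le_size _).trans ((hm _).trans ?_)
  simp only [Polynomial.eval_comp, Polynomial.eval_add, Polynomial.eval_mul, Polynomial.eval_ofNat,
    Polynomial.eval_X]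
  refine polynomial_eval_mono qm ?_
  have hd' := (size_le_of_mem_toList hd).trans (hu _)
  have hd'' : d.size ≤ qu.eval (2 * (I.enc.size + ∑ s ∈ kb, (s.size + 1)) + 3) :=
    hd'.trans (polynomial_eval_mono qu (by simp only [size]; omega))
  simp only [size]
  omega

/-- For finite `N` the one-step bound is composed with itself a constant number of times. The degree
may grow with every step, so without a bound on time polynomial growth has to be assumed. -/
theorem exists_growth_bound (F : 𝓛.Realizer) {N : ℕ∞} (h : N ≠ ⊤ ∨ 𝓛.PolyGrowth) :
    ∃ q : Polynomial ℕ, ∀ I : QueryInstance 𝓛.K, 𝓛.Valid I → (I.acts.length : ℕ∞) ≤ N →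
      ∀ t kb S, 𝓛.IsRun I.sys I.acts t kb S → ∀ T ≤ t, ∀ i,
        ∑ s ∈ kb T i, (s.size + 1) ≤ q.eval I.enc.size := by
  rcases h with hN | ⟨q, hq⟩
  swap
  · exact ⟨q, fun I hI _ => hq I hI⟩
  lift N to ℕ using hN
  obtain ⟨P, hP⟩ := sum_mng_le F
  have key : ∀ T₀ : ℕ, ∃ q : Polynomial ℕ, ∀ I : QueryInstance 𝓛.K, 𝓛.Valid I →
      ∀ t kb S, 𝓛.IsRun I.sys I.acts t kb S → ∀ T ≤ t, T ≤ T₀ → ∀ i,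
        ∑ s ∈ kb T i, (s.size + 1) ≤ q.eval I.enc.size := by
    intro T₀
    induction T₀ with
    | zero =>
      refine ⟨.X, fun I hI t kb S hrun T _ hT i => ?_⟩
      obtain rfl : T = 0 := by omega
      rw [(hrun.1 i).1, ← toFinset_ofList, Polynomial.eval_X, ← kbOf_enc]
      exact (sum_toFinset_le_size _).trans (size_kbOf_le _ _)
    | succ T₀ ih =>
      obtain ⟨q, hq⟩ := ih
      -- The summand `q` keeps the bound valid for the earlier times as well.
      refine ⟨q + P.comp (.X + q), fun I hI t kb S hrun T hT hT₀ i => ?_⟩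
      simp only [Polynomial.eval_comp, Polynomial.eval_add, Polynomial.eval_X]
      rcases Nat.lt_or_ge T₀ T with h | h
      · obtain rfl : T = T₀ + 1 := by omega
        obtain ⟨a, ha, hstep⟩ := hrun.2 T₀ hT
        obtain ⟨⟨kb', hkb', e⟩, -⟩ := hstep i
        rw [e]
        refine (hP I hI i _ _ kb' T₀ a ⟨_, List.filter_sublist.map _, rfl⟩
          (hrun.mem_KB hI T₀ (by omega) i) ha hkb').trans (le_trans ?_ (Nat.le_add_left _ _))
        exact polynomial_eval_mono P
          (Nat.add_le_add_left (hq I hI t kb S hrun T₀ (by omega) le_rfl i) _)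
      · exact (hq I hI t kb S hrun T hT h i).trans (Nat.le_add_right _ _)
  obtain ⟨q, hq⟩ := key N
  refine ⟨q, fun I hI hlen t kb S hrun T hT i => hq I hI t kb S hrun T hT ?_ i⟩
  refine le_trans ?_ (Nat.cast_le.1 hlen)
  rcases T with _ | T
  · exact Nat.zero_le _
  · obtain ⟨a, ha, -⟩ := hrun.2 T hT
    exact (List.getElem?_eq_some_iff.1 ha).1

/-- The language of the instances of the query problem with an equilibrium whose answer to the query
is `b`, up to data that are not instances. -/
theorem exists_npConjReducible (h𝓛 : 𝓛.IsPolyTime) {N : ℕ∞} (hN : N ≠ ⊤ ∨ 𝓛.PolyGrowth) (b : Prop)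
    {A : Fin 𝓛.K → Set Data}
    (hA : ∀ k, ∀ y ∈ (𝓛.kind k).contextProblem.instances,
      (y ∈ A k ↔ y ∈ (𝓛.kind k).contextProblem.yes)) :
    ∃ L, NPConjReducible L (join A) ∧
      ∀ I : QueryInstance 𝓛.K, 𝓛.Valid I → (I.acts.length : ℕ∞) ≤ N → (I.enc ∈ L ↔
        ∃ t ≤ I.acts.length, ∃ E, 𝓛.IsTimedEquilibrium I.sys I.acts t E ∧
          (I.query ∈ E I.ctx ↔ b)) := by
  obtain ⟨F⟩ := h𝓛.nonempty_realizer
  obtain ⟨q, hq⟩ := exists_growth_bound F hN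
  obtain ⟨r, hr⟩ := polyTime_relevant.size_le
  -- The bound of `size_certificate_le`, with the growth bound `q` for `B` and `r` for the size of
  -- the relevant beliefs.
  let p : Polynomial ℕ := 2 * .X + 3 + .X * (2 + .X * (2 * .X + q + r + 3))
  have hred : ∀ x w, (∃ qs : List Data, reduction F b (.node x w) = .node .leaf (.ofList qs) ∧
      ∀ q ∈ qs, q ∈ join A) ↔
      Accepts F b x w ∧ ∀ q ∈ (contextQueries F x w).toList, q ∈ join A := by
    intro x w
    simp only [reduction, left_node, right_node]
    by_cases h : Accepts F b x w
    · simp only [h, if_true, true_and, Data.node.injEq]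
      constructor
      · rintro ⟨qs, e, hqs⟩
        rwa [e, toList_ofList]
      · exact fun h => ⟨_, (ofList_toList _).symm, h⟩
    · simp [h]
  refine ⟨{x | ∃ w, w.size ≤ p.eval x.size ∧ Accepts F b x w ∧
    ∀ q ∈ (contextQueries F x w).toList, q ∈ join A},
    ⟨reduction F b, p, polyTime_reduction F b, fun x => ?_⟩, fun I hI hlen => ⟨?_, ?_⟩⟩
  · exact exists_congr fun w => and_congr_right fun _ => (hred x w).symm
  · rintro ⟨w, -, h1, h2⟩
    exact sound F hA hI h1 h2
  · rintro ⟨t, ht, E, ⟨ht1, kb, S, hrun, rfl⟩, hb⟩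
    refine ⟨certificate I t kb S, ?_, complete F hA hI ht1 ht hrun hb⟩
    refine (size_certificate_le I t kb S ht (hq I hI hlen t kb S hrun)).trans ?_
    have := hr I.enc
    simp only [p, Polynomial.eval_add, Polynomial.eval_mul, Polynomial.eval_ofNat,
      Polynomial.eval_X]
    gcongr

/-- The target class `𝒟` is kept abstract so as to cover both `NPRel 𝒞` and a closed `𝒞`. For the
universal query the reduction is used for the counterexamples, and the complement of their language
is taken. -/
theorem membership (h𝓛 : 𝓛.IsPolyTime) {N : ℕ∞} (hN : N ≠ ⊤ ∨ 𝓛.PolyGrowth)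
    {𝒞 𝒟 : Set (Set Data)} (h𝒞 : 𝓛.SystemContextComplexityIn 𝒞)
    (h𝒟 : ∀ (m : ℕ) (A : Fin m → Set Data), (∀ j, A j ∈ 𝒞) →
      ∀ L, NPConjReducible L (join A) → L ∈ 𝒟) :
    (𝓛.QExists N).MemClass 𝒟 ∧ (𝓛.QForall N).MemClass (co 𝒟) := by
  choose A hA𝒞 hA using h𝒞
  constructor
  · obtain ⟨L, hL, h⟩ := exists_npConjReducible h𝓛 hN True hA
    simp only [iff_true] at h
    refine ⟨L, h𝒟 _ A hA𝒞 L hL, ?_⟩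
    rintro x ⟨I, rfl, hI, hlen⟩
    constructor
    · exact fun hx => ⟨I, rfl, hI, hlen, (h I hI hlen).1 hx⟩
    · rintro ⟨J, e, hJ, hlen', hyes⟩
      rw [e]
      exact (h J hJ hlen').2 hyes
  · obtain ⟨L, hL, h⟩ := exists_npConjReducible h𝓛 hN False hA
    have h' : ∀ I : QueryInstance 𝓛.K, 𝓛.Valid I → (I.acts.length : ℕ∞) ≤ N →
        (I.enc ∈ Lᶜ ↔ 𝓛.QForallHolds I) := by
      intro I hI hlen
      rw [Set.mem_compl_iff, h I hI hlen, QForallHolds]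
      push Not
      simp
    refine ⟨Lᶜ, by simpa [co] using h𝒟 _ A hA𝒞 L hL, ?_⟩
    rintro x ⟨I, rfl, hI, hlen⟩
    constructor
    · exact fun hx => ⟨I, rfl, hI, hlen, (h' I hI hlen).1 hx⟩
    · rintro ⟨J, e, hJ, hlen', hyes⟩
      rw [e]
      exact (h' J hJ hlen').2 hyes

end Library

/-! ### Instances are determined by their codes -/

theorem BridgeRule.enc_injective {n : ℕ} : Function.Injective (BridgeRule.enc (n := n)) := by
  have hlit : Function.Injective fun b : Fin n × Data => Data.node (.ofNat b.1) b.2 := by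
    rintro ⟨a, b⟩ ⟨c, d⟩ h
    simp only [Data.node.injEq] at h
    rw [Prod.mk.injEq]
    exact ⟨Fin.ext (ofNat_injective h.1), h.2⟩
  rintro ⟨h₁, p₁, n₁⟩ ⟨h₂, p₂, n₂⟩ h
  simp only [BridgeRule.enc, Data.node.injEq] at h
  obtain ⟨e1, e2, e3⟩ := h
  rw [BridgeRule.mk.injEq]
  exact ⟨OpStmt.enc_injective e1, hlit.list_map (ofList_injective e2),
    hlit.list_map (ofList_injective e3)⟩

/-- For hardness a negative answer must exclude every instance with the given code. The number of
contexts is recovered first, from the length of a list, since the types of the other components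
depend on it. -/
theorem QueryInstance.enc_injective {K : ℕ} : Function.Injective (QueryInstance.enc (K := K)) := by
  rintro ⟨⟨n, kind, kb, bel, rules⟩, acts, ctx, q⟩ ⟨⟨n', kind', kb', bel', rules'⟩, acts', ctx', q'⟩ h
  simp only [QueryInstance.enc, System.enc, Data.node.injEq] at h
  obtain ⟨⟨h1, h2⟩, h3, rfl⟩ := h
  have h1 := ofList_injective h1
  obtain rfl : n = n' := by simpa using congrArg List.length h1
  have h1 := fun i => congrFun (List.ofFn_injective h1) i
  simp only [Data.node.injEq] at h1
  obtain rfl : kind = kind' := funext fun i => Fin.ext (ofNat_injective (h1 i).1.1)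
  obtain rfl : kb = kb' := funext fun i => ofList_injective (h1 i).1.2
  obtain rfl : bel = bel' := funext fun i => ofList_injective (h1 i).2.1
  obtain rfl : rules = rules' := funext fun i =>
    BridgeRule.enc_injective.list_map (ofList_injective (h1 i).2.2)
  obtain rfl : ctx = ctx' := Fin.ext (ofNat_injective h3)
  obtain rfl : acts = acts' := by
    refine Function.Injective.list_map (fun a a' h => ?_) (ofList_injective h2)
    exact funext fun i => ofList_injective (congrFun (List.ofFn_injective (ofList_injective h)) i)
  rfl

namespace Library

variable {𝓛 : Library} {I : QueryInstance 𝓛.K} {N : ℕ∞}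

theorem enc_mem_QExists_yes (hI : 𝓛.Valid I) (hN : (I.acts.length : ℕ∞) ≤ N) :
    I.enc ∈ (𝓛.QExists N).yes ↔ 𝓛.QExistsHolds I := by
  constructor
  · rintro ⟨J, e, -, -, h⟩
    rwa [QueryInstance.enc_injective e]
  · exact fun h => ⟨I, rfl, hI, hN, h⟩

theorem enc_mem_QForall_yes (hI : 𝓛.Valid I) (hN : (I.acts.length : ℕ∞) ≤ N) :
    I.enc ∈ (𝓛.QForall N).yes ↔ 𝓛.QForallHolds I := by
  constructor
  · rintro ⟨J, e, -, -, h⟩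
    rwa [QueryInstance.enc_injective e]
  · exact fun h => ⟨I, rfl, hI, hN, h⟩

end Library

/-! A context without bridge rules is observed by a fact base, which notes at time `1` whether the
projection of the belief set to `R` is `P`. The fact `leaf`, added by an action, switches the
rules on at time `1`; the fact `1` stands for *yes* and the fact `2` for *no*. -/

namespace Observer

/-- The rule by which the fact base notes that the projection to `R` is `P`. -/
def yesRule (R P : List Data) : BridgeRule 2 where
  head := (.leaf, .ofNat 1)
  -- The literal `(1, .leaf)` is false at time 0, when the fact base is empty, and so prevents a
  -- note about the arbitrary initial belief set.
  pos := (1, .leaf) :: P.map fun p => (0, p)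
  neg := (R.filter fun r => decide (r ∉ P)).map fun r => (0, r)

/-- The rule by which the fact base notes that the projection is another one. -/
def noRule : BridgeRule 2 where
  head := (.leaf, .ofNat 2)
  pos := [(1, .leaf)]
  neg := [(1, .ofNat 1)]

/-- The observed context, of kind `k`, and the fact base, of kind `k₀`. -/
abbrev observer {K : ℕ} (k₀ k : Fin K) (kb bel act R P : List Data) (q : Data) :
    QueryInstance K where
  sys :=
    { n := 2
      kind := ![k, k₀]
      kb := ![kb, []]
      bel := ![bel, []]
      rules := ![[], [yesRule R P, noRule]] }
  acts := [![act, [.leaf]]]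
  ctx := 1
  query := q

/-- The explicit form makes visible that the code is composed of constants and of lists computable
from the parameters. -/
theorem observer_enc {K : ℕ} (k₀ k : Fin K) (kb bel act R P : List Data) (q : Data) :
    (observer k₀ k kb bel act R P q).enc =
      .node (.node (.node (.node (.node (.ofNat k) (.ofList kb)) (.node (.ofList bel) .leaf))
          (.node (.node (.node (.ofNat k₀) .leaf) (.node .leaf (.node (.node (.node .leaf (.ofNat 1))
            (.node (.node (.node (.ofNat 1) .leaf) (.ofList (P.map fun p => .node .leaf p)))
              (.ofList ((R.filter fun r => decide (r ∉ P)).map fun r => .node .leaf r))))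
            (.node noRule.enc .leaf)))) .leaf))
        (.node (.node (.ofList act) (.node (.node .leaf .leaf) .leaf)) .leaf))
        (.node (.ofNat 1) q) := by
  simp [observer, QueryInstance.enc, System.enc, List.ofFn_succ, ofList, yesRule, BridgeRule.enc,
    OpStmt.enc, Function.comp_def, ofNat]

/-- The positive literals say that `P` is contained in the belief set, the negative ones that
nothing else from `R` is. -/
theorem yesRule_holds {R P : List Data} (hP : P ⊆ R) {S : Fin 2 → Finset Data} :
    (yesRule R P).Holds S ↔ .leaf ∈ S 1 ∧ S 0 ∩ R.toFinset = P.toFinset := by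
  simp only [yesRule, BridgeRule.Holds, List.forall_mem_cons, List.forall_mem_map,
    List.mem_filter, decide_eq_true_eq, and_assoc, Finset.ext_iff, Finset.mem_inter,
    List.mem_toFinset]
  refine and_congr_right fun _ => ⟨fun ⟨h1, h2⟩ p => ⟨fun ⟨h3, h4⟩ => ?_, fun h => ⟨h1 p h, hP h⟩⟩,
    fun h => ⟨fun p hp => ((h p).2 hp).1, fun p hp hS => hp.2 ((h p).1 ⟨hS, hp.1⟩)⟩⟩
  by_contra h5
  exact h2 p ⟨h4, h5⟩ h3

theorem noRule_holds {S : Fin 2 → Finset Data} :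
    noRule.Holds S ↔ .leaf ∈ S 1 ∧ .ofNat 1 ∉ S 1 := by
  simp [noRule, BridgeRule.Holds]

variable {𝓛 : Library} {k₀ k : Fin 𝓛.K} {kb bel act R P : List Data} {q : Data}

theorem app_zero (κ S : ℕ → Fin 2 → Finset Data) (T : ℕ) :
    𝓛.app (observer k₀ k kb bel act R P q).sys κ S T 0 = ∅ := rfl

theorem mem_app_one (hk₀ : 𝓛.kind k₀ = ContextKind.factBase) (κ S : ℕ → Fin 2 → Finset Data)
    (T : ℕ) (h : OpStmt) :
    h ∈ 𝓛.app (observer k₀ k kb bel act R P q).sys κ S T 1 ↔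
      ((yesRule R P).Holds (S T) ∧ h = (.leaf, .ofNat 1)) ∨
        (noRule.Holds (S T) ∧ h = (.leaf, .ofNat 2)) := by
  have htrig : ∀ ρ ∈ [yesRule R P, noRule], ∃ T' ≤ T,
      𝓛.Triggered (observer k₀ k kb bel act R P q).sys κ T' 1 ρ := fun ρ hρ => by
    refine ⟨T, le_rfl, ?_⟩
    change _ ∈ (𝓛.kind k₀).trig _ _ _
    rw [hk₀]
    exact List.mem_toFinset.2 (List.mem_map_of_mem hρ)
  refine List.mem_toFinset.trans (List.mem_map.trans ?_)
  change (∃ ρ, ρ ∈ List.filter _ [yesRule R P, noRule] ∧ _) ↔ _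
  simp only [List.mem_filter, decide_eq_true_eq]
  constructor
  · rintro ⟨ρ, ⟨hρ, -, h1⟩, rfl⟩
    rcases List.mem_pair.1 hρ with rfl | rfl
    · exact .inl ⟨h1, rfl⟩
    · exact .inr ⟨h1, rfl⟩
  · rintro (⟨h1, rfl⟩ | ⟨h1, rfl⟩)
    · exact ⟨yesRule R P, ⟨by simp, htrig _ (by simp), h1⟩, rfl⟩
    · exact ⟨noRule, ⟨by simp, htrig _ (by simp), h1⟩, rfl⟩

/-- Both rules are guarded by `leaf`. Applied at time 0, this ensures that no note made there is
carried into the knowledge base at time 1. -/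
theorem app_one_eq_empty (hk₀ : 𝓛.kind k₀ = ContextKind.factBase)
    {κ S : ℕ → Fin 2 → Finset Data} {T : ℕ} (h : .leaf ∉ S T 1) :
    𝓛.app (observer k₀ k kb bel act R P q).sys κ S T 1 = ∅ := by
  refine Finset.eq_empty_of_forall_notMem fun x hx => ?_
  rcases (mem_app_one hk₀ κ S T x).1 hx with ⟨hx, -⟩ | ⟨hx, -⟩
  · exact h (hx.1 _ List.mem_cons_self)
  · exact h (hx.1 _ List.mem_cons_self)

/-- What the fact base knows at time `1` when `S` is the belief set of the observed context. -/
def notes (R P : List Data) (S : Finset Data) : Finset Data :=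
  {.leaf, if S ∩ R.toFinset = P.toFinset then .ofNat 1 else .ofNat 2}

theorem ofNat_one_mem_notes {S : Finset Data} :
    .ofNat 1 ∈ notes R P S ↔ S ∩ R.toFinset = P.toFinset := by
  by_cases h : S ∩ R.toFinset = P.toFinset <;> simp [notes, h, ofNat]

theorem ofNat_two_mem_notes {S : Finset Data} :
    .ofNat 2 ∈ notes R P S ↔ ¬S ∩ R.toFinset = P.toFinset := by
  by_cases h : S ∩ R.toFinset = P.toFinset <;> simp [notes, h, ofNat]

/-- Acceptability at time 1 is a fixed-point equation, as the rules are evaluated in the very belief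
set they produce. They are stratified: `leaf` is present, `yesRule` then depends only on the
observed context, and `noRule` on whether `1` was derived. Hence the solution is unique. -/
theorem eq_notes_iff (hk₀ : 𝓛.kind k₀ = ContextKind.factBase) (hP : P ⊆ R)
    (κ S : ℕ → Fin 2 → Finset Data) (T : ℕ) :
    S T 1 = {.leaf} ∪ (𝓛.app (observer k₀ k kb bel act R P q).sys κ S T 1).image Prod.snd ↔
      S T 1 = notes R P (S T 0) := by
  have key : ∀ x, x ∈ (𝓛.app (observer k₀ k kb bel act R P q).sys κ S T 1).image Prod.snd ↔
      ((yesRule R P).Holds (S T) ∧ x = .ofNat 1) ∨ (noRule.Holds (S T) ∧ x = .ofNat 2) := by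
    intro x
    rw [Finset.mem_image]
    constructor
    · rintro ⟨h, hh, rfl⟩
      rcases (mem_app_one hk₀ κ S T h).1 hh with h1 | h1
      · exact .inl ⟨h1.1, by rw [h1.2]⟩
      · exact .inr ⟨h1.1, by rw [h1.2]⟩
    · rintro (⟨h1, rfl⟩ | ⟨h1, rfl⟩)
      · exact ⟨_, (mem_app_one hk₀ κ S T _).2 (.inl ⟨h1, rfl⟩), rfl⟩
      · exact ⟨_, (mem_app_one hk₀ κ S T _).2 (.inr ⟨h1, rfl⟩), rfl⟩
  generalize (𝓛.app (observer k₀ k kb bel act R P q).sys κ S T 1).image Prod.snd = X at key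
  simp only [yesRule_holds hP, noRule_holds] at key
  rw [Finset.ext_iff, Finset.ext_iff]
  simp only [Finset.mem_union, Finset.mem_singleton, key]
  constructor
  · intro h x
    have h0 : .leaf ∈ S T 1 := (h _).2 (.inl rfl)
    have h1 := h (.ofNat 1)
    have h2 : x ∈ S T 1 ↔ _ := h x
    simp only [h0, true_and, ofNat, reduceCtorEq, Data.node.injEq, and_true, false_or, and_false,
      or_false] at h1 h2
    by_cases hc : S T 0 ∩ R.toFinset = P.toFinset <;>
      simp [notes, hc, h1, h2, ofNat]
  · intro h x
    have h0 : .leaf ∈ S T 1 := (h _).2 (by simp [notes])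
    have h1 := (h (.ofNat 1)).trans ofNat_one_mem_notes
    rw [h x]
    by_cases hc : S T 0 ∩ R.toFinset = P.toFinset <;>
      simp [notes, hc, h1, h0]

/-- The observed context can be started in `kb`, and does not change it. -/
structure Startable (C : ContextKind) (kb bel act : List Data) : Prop where
  kb_mem : kb.toFinset ∈ C.KB
  bel_mem : bel.toFinset ∈ C.Cn
  act_mem : ∀ e ∈ act, e ∈ C.act
  upd_eq : C.upd kb.toFinset act.toFinset = {kb.toFinset}
  mng_eq : C.mng ∅ kb.toFinset = kb.toFinset

theorem valid (hk₀ : 𝓛.kind k₀ = ContextKind.factBase) (h : Startable (𝓛.kind k) kb bel act) :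
    𝓛.Valid (observer k₀ k kb bel act R P q) := by
  intro i
  match i with
  | 0 =>
    refine ⟨h.kb_mem, h.bel_mem, fun ρ hρ => absurd hρ List.not_mem_nil, fun a ha => ?_⟩
    rw [List.mem_singleton.1 ha]
    exact h.act_mem
  | 1 =>
    change _ ∈ (𝓛.kind k₀).KB ∧ _ ∈ (𝓛.kind k₀).Cn ∧ (∀ ρ ∈ _, _ ∈ (𝓛.kind k₀).opStmts) ∧
      ∀ a ∈ _, ∀ e ∈ _, e ∈ (𝓛.kind k₀).act
    rw [hk₀]
    exact ⟨Set.mem_univ _, Set.mem_univ _, fun ρ _ => ⟨Set.mem_univ _, {ρ.head.2},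
      Set.mem_univ _, Finset.mem_singleton_self _⟩, fun _ _ _ _ => Set.mem_univ _⟩

/-- The observed context has no rules and is kept fixed by its action, so at time 1 it may take any
set acceptable for `kb`; the fact base then has exactly one possible belief set. -/
theorem isTimedEquilibrium_iff (hk₀ : 𝓛.kind k₀ = ContextKind.factBase) (hP : P ⊆ R)
    (h : Startable (𝓛.kind k) kb bel act) {E : Fin 2 → Finset Data} :
    𝓛.IsTimedEquilibrium (observer k₀ k kb bel act R P q).sys
      (observer k₀ k kb bel act R P q).acts 1 E ↔
      E 0 ∈ (𝓛.kind k).ACC kb.toFinset ∧ E 1 = notes R P (E 0) := by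
  constructor
  · rintro ⟨-, κ, S, ⟨h0, h1⟩, rfl⟩
    obtain ⟨a, ha, hstep⟩ := h1 0 one_pos
    obtain rfl : a = ![act, [.leaf]] := (Option.some.inj ha).symm
    obtain ⟨⟨kb₀, hkb₀, e₀⟩, hS₀⟩ := hstep 0
    obtain ⟨⟨kb₁, hkb₁, e₁⟩, hS₁⟩ := hstep 1
    have hκ₀ : κ 0 0 = kb.toFinset := (h0 0).1
    have hκ₁ : κ 0 1 = ∅ := (h0 1).1
    have hb₁ : S 0 1 = ∅ := (h0 1).2
    rw [app_zero] at e₀ hS₀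
    rw [app_one_eq_empty hk₀ (h := by rw [hb₁]; exact Finset.notMem_empty _)] at e₁
    change kb₀ ∈ (𝓛.kind k).upd (κ 0 0) act.toFinset at hkb₀
    rw [hκ₀, h.upd_eq, Finset.mem_singleton] at hkb₀
    change κ 1 0 = (𝓛.kind k).mng ∅ kb₀ at e₀
    change S 1 0 ∈ (𝓛.kind k).ACC ((𝓛.kind k).mng ∅ (κ 1 0)) at hS₀
    -- Neutrality of management is used twice: for the passage to time 1 and in the acceptability
    -- condition there.
    rw [e₀, hkb₀, h.mng_eq, h.mng_eq] at hS₀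
    refine ⟨hS₀, (eq_notes_iff (q := q) (k := k) (kb := kb) (bel := bel) (act := act)
      hk₀ hP κ S 1).1 ?_⟩
    change kb₁ ∈ (𝓛.kind k₀).upd _ _ at hkb₁
    change κ 1 1 = (𝓛.kind k₀).mng _ _ at e₁
    change S 1 1 ∈ (𝓛.kind k₀).ACC ((𝓛.kind k₀).mng _ _) at hS₁
    rw [hk₀] at hkb₁ e₁ hS₁
    change kb₁ ∈ ({κ 0 1 ∪ {.leaf}} : Finset (Finset Data)) at hkb₁
    rw [hκ₁, Finset.empty_union, Finset.mem_singleton] at hkb₁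
    change κ 1 1 = kb₁ ∪ ∅ at e₁
    rw [hkb₁, Finset.union_empty] at e₁
    change S 1 1 ∈ ({κ 1 1 ∪ _} : Set (Finset Data)) at hS₁
    rw [e₁, Set.mem_singleton_iff] at hS₁
    exact hS₁
  · rintro ⟨hE₀, hE₁⟩
    let κ : ℕ → Fin 2 → Finset Data := fun T =>
      if T = 0 then ![kb.toFinset, ∅] else ![kb.toFinset, {.leaf}]
    let S : ℕ → Fin 2 → Finset Data := fun T => if T = 0 then ![bel.toFinset, ∅] else E
    refine ⟨le_rfl, κ, S, ⟨fun i => ?_, fun T hT => ?_⟩, rfl⟩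
    · match i with
      | 0 => exact ⟨rfl, rfl⟩
      | 1 => exact ⟨rfl, rfl⟩
    · obtain rfl : T = 0 := by omega
      refine ⟨_, rfl, fun i => ?_⟩
      match i with
      | 0 =>
        rw [app_zero, app_zero]
        refine ⟨⟨kb.toFinset, ?_, h.mng_eq.symm⟩, ?_⟩
        · change _ ∈ (𝓛.kind k).upd kb.toFinset act.toFinset
          rw [h.upd_eq]
          exact Finset.mem_singleton_self _
        · change E 0 ∈ (𝓛.kind k).ACC ((𝓛.kind k).mng ∅ kb.toFinset)
          rwa [h.mng_eq]
      | 1 =>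
        rw [app_one_eq_empty hk₀ (S := S) (T := 0) (h := Finset.notMem_empty _)]
        change (∃ kb' ∈ (𝓛.kind k₀).upd _ _, _ = (𝓛.kind k₀).mng _ _) ∧
          _ ∈ (𝓛.kind k₀).ACC ((𝓛.kind k₀).mng _ _)
        rw [hk₀]
        refine ⟨⟨{.leaf}, Finset.mem_singleton_self _, rfl⟩, ?_⟩
        exact (eq_notes_iff hk₀ hP κ S 1).2 hE₁

theorem qExistsHolds_iff (hk₀ : 𝓛.kind k₀ = ContextKind.factBase) (hP : P ⊆ R)
    (h : Startable (𝓛.kind k) kb bel act) :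
    𝓛.QExistsHolds (observer k₀ k kb bel act R P (.ofNat 1)) ↔
      ∃ S ∈ (𝓛.kind k).ACC kb.toFinset, S ∩ R.toFinset = P.toFinset := by
  constructor
  · rintro ⟨t, ht, E, hE, hq⟩
    obtain rfl : t = 1 := le_antisymm ht hE.1
    obtain ⟨h1, h2⟩ := (isTimedEquilibrium_iff hk₀ hP h).1 hE
    exact ⟨_, h1, ofNat_one_mem_notes.1 (h2 ▸ hq)⟩
  · rintro ⟨S, h1, h2⟩
    exact ⟨1, le_rfl, ![S, notes R P S], (isTimedEquilibrium_iff hk₀ hP h).2 ⟨h1, rfl⟩,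
      ofNat_one_mem_notes.2 h2⟩

/-- A query asks for the presence of a belief, so the failure of the projection needs a fact of its
own. If there is no equilibrium, both sides hold. -/
theorem qForallHolds_iff (hk₀ : 𝓛.kind k₀ = ContextKind.factBase) (hP : P ⊆ R)
    (h : Startable (𝓛.kind k) kb bel act) :
    𝓛.QForallHolds (observer k₀ k kb bel act R P (.ofNat 2)) ↔
      ¬∃ S ∈ (𝓛.kind k).ACC kb.toFinset, S ∩ R.toFinset = P.toFinset := by
  constructor
  · rintro hq ⟨S, h1, h2⟩
    exact ofNat_two_mem_notes.1 (hq 1 le_rfl ![S, notes R P S]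
      ((isTimedEquilibrium_iff hk₀ hP h).2 ⟨h1, rfl⟩)) h2
  · intro hS t ht E hE
    obtain rfl : t = 1 := le_antisymm ht hE.1
    obtain ⟨h1, h2⟩ := (isTimedEquilibrium_iff hk₀ hP h).1 hE
    exact h2 ▸ ofNat_two_mem_notes.2 fun h3 => hS ⟨_, h1, h3⟩

theorem polyTime_observer {K : ℕ} (k₀ k : Fin K) (bel act : List Data) (q : Data)
    {kb R P : Data → Data} (hkb : PolyTimeWith ∅ kb) (hR : PolyTimeWith ∅ R)
    (hP : PolyTimeWith ∅ P) :
    PolyTimeWith ∅ fun y =>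
      (observer k₀ k (kb y).toList bel act (R y).toList (P y).toList q).enc := by
  simp only [observer_enc]
  have id := PolyTimeWith.id (A := ∅)
  have c := fun d => PolyTimeWith.const (A := ∅) d
  have h1 : PolyTimeWith ∅ fun y => ofList ((P y).toList.map fun p => .node .leaf p) :=
    hP.map (F := fun _ p => .node .leaf p) ((c _).node id.right)
  have h2 : PolyTimeWith ∅ fun y =>
      ofList (((R y).toList.filter fun r => decide (r ∉ (P y).toList)).map
        fun r => .node .leaf r) := by
    have := (PolyDec.filter (p := fun y r => r ∉ (P y).toList) hR
      (PolyDec.mem id.right (hP.comp id.left)).not).map (F := fun _ p => .node .leaf p)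
        ((c _).node id.right)
    simpa using this
  have h3 : PolyTimeWith ∅ fun y => ofList (kb y).toList := by simpa using hkb
  exact ((((((c _).node h3).node (c _))).node (((c _).node ((c _).node (((c _).node
    (((c _).node h1).node h2)).node (c _)))).node (c _))).node (c _)).node (c _)

end Observer

/-! ### Hardness -/

namespace Library

open Observer

variable {𝓛 : Library}

/-- The kind of fact bases in the extended library. -/
def factKind (𝓛 : Library) : Fin 𝓛.withFactBase.K := (0 : Fin (𝓛.K + 1))

/-- The kinds of a library in the extended library. -/
def oldKind (k : Fin 𝓛.K) : Fin 𝓛.withFactBase.K := k.succ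

theorem kind_factKind : 𝓛.withFactBase.kind 𝓛.factKind = ContextKind.factBase := rfl

theorem kind_oldKind (k : Fin 𝓛.K) : 𝓛.withFactBase.kind (oldKind k) = 𝓛.kind k := rfl

/-- The reduction itself computes `mng H kb` and starts the observed context there, so the heads `H`
need not be produced by bridge rules. -/
theorem exists_observer (h𝓛 : 𝓛.IsPolyTime) (hN : 𝓛.IsNeutral) (q : Data) (k : Fin 𝓛.K) :
    ∃ g, PolyTimeWith ∅ g ∧ ∀ y ∈ (𝓛.kind k).contextProblem.instances,
      ∃ (k' : Fin 𝓛.withFactBase.K) (kb bel act R P : List Data), P ⊆ R ∧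
        Startable (𝓛.withFactBase.kind k') kb bel act ∧
        g y = (observer 𝓛.factKind k' kb bel act R P q).enc ∧
        (y ∈ (𝓛.kind k).contextProblem.yes ↔
          ∃ S ∈ (𝓛.withFactBase.kind k').ACC kb.toFinset, S ∩ R.toFinset = P.toFinset) := by
  have id := PolyTimeWith.id (A := ∅)
  obtain ⟨f, hf, hmng⟩ := (h𝓛 k).1
  obtain ⟨⟨a, ha, hupd⟩, hneut⟩ := hN k
  -- A system needs an initial belief set. If the logic has none, nothing is acceptable and every
  -- answer is no.
  by_cases hCn : ((𝓛.kind k).Cn).Nonempty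
  · obtain ⟨B, hB⟩ := hCn
    refine ⟨_, polyTime_observer 𝓛.factKind (oldKind k) B.toList a.toList q
      (PolyTimeWith.comp hf id.left) id.right.left id.right.right, ?_⟩
    rintro y ⟨H, kb, R, P, rfl, hH, hkb, hP⟩
    have e : (f (.node (.ofList (H.map OpStmt.enc)) (.ofList kb))).toList.toFinset =
      (𝓛.kind k).mng H.toFinset kb.toFinset := hmng H kb hH hkb
    have hmem : (𝓛.kind k).mng H.toFinset kb.toFinset ∈ (𝓛.kind k).KB :=
      ContextKind.mng_mem _ _ _ hkb fun h hh => hH h (List.mem_toFinset.1 hh)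
    refine ⟨oldKind k, (f (.node (.ofList (H.map OpStmt.enc)) (.ofList kb))).toList, B.toList,
      a.toList, R, P, hP, ?_, by simp [ContextKind.encContextInstance], ?_⟩
    · rw [kind_oldKind]
      refine ⟨?_, ?_, fun x hx => ha (by simpa using hx), ?_, ?_⟩
      · rwa [e]
      · rwa [Finset.toList_toFinset]
      · rw [Finset.toList_toFinset, e]
        exact hupd _ hmem
      · rw [e]
        exact hneut _ hmem
    · have := (ContextKind.mem_contextProblem_yes (C := 𝓛.kind k) (H := H) (d := ofList kb)
        (R := ofList R) (P := ofList P) hH (by simpa using hkb) (by simpa using hP)).2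
      simp only [toFinset_ofList] at this
      rw [ContextKind.encContextInstance, this, kind_oldKind, e]
  -- A fixed negative instance: an empty fact base is observed, and the projection to `[leaf]` is
  -- asked to be `[leaf]`.
  · refine ⟨_, PolyTimeWith.const (observer 𝓛.factKind 𝓛.factKind [] [] [] [.leaf] [.leaf] q).enc,
      fun y _ => ⟨𝓛.factKind, [], [], [], [.leaf], [.leaf], List.Subset.refl _, ⟨Set.mem_univ _,
      Set.mem_univ _, fun _ _ => Set.mem_univ _, rfl, rfl⟩, rfl, iff_of_false ?_ ?_⟩⟩
    · rintro ⟨H, kb, R, P, -, hH, hkb, -, S, hS, -⟩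
      refine hCn ⟨S, (𝓛.kind k).ACC_subset _ ?_ hS⟩
      exact ContextKind.mng_mem _ _ _ hkb fun h hh => hH h (List.mem_toFinset.1 hh)
    · rintro ⟨S, hS, e⟩
      obtain rfl : S = ∅ := hS
      simp at e

theorem exists_observer_of_hard (h𝓛 : 𝓛.IsPolyTime) (hN : 𝓛.IsNeutral) {𝒞 : Set (Set Data)}
    (h : 𝓛.systemContextProblem.Hard 𝒞) (q : Data) {L : Set Data} (hL : L ∈ 𝒞) :
    ∃ g, PolyTime g ∧ ∀ x, ∃ (k : Fin 𝓛.withFactBase.K) (kb bel act R P : List Data), P ⊆ R ∧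
        Startable (𝓛.withFactBase.kind k) kb bel act ∧
        g x = (observer 𝓛.factKind k kb bel act R P q).enc ∧
        (x ∈ L ↔ ∃ S ∈ (𝓛.withFactBase.kind k).ACC kb.toFinset, S ∩ R.toFinset = P.toFinset) := by
  obtain ⟨f, hf, hfL⟩ := h L hL
  choose g hg hgy using exists_observer h𝓛 hN q
  obtain ⟨G, hG, hGk⟩ := exists_polyTimeWith_dispatch g hg
  refine ⟨_, PolyTimeWith.comp hG hf, fun x => ?_⟩
  obtain ⟨⟨k, y, e, hy⟩, hx⟩ := hfL x
  obtain ⟨k', kb, bel, act, R, P, hP, hs, e', hyes⟩ := hgy k y hy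
  refine ⟨k', kb, bel, act, R, P, hP, hs, by rw [e, hGk, e'], ?_⟩
  rw [hx, ← hyes, e]
  exact join_node_ofNat (A := fun k => (𝓛.kind k).contextProblem.yes)

theorem hardness (h𝓛 : 𝓛.IsPolyTime) {N : ℕ∞} (h1 : 1 ≤ N) (hN : 𝓛.IsNeutral)
    {𝒞 : Set (Set Data)} (h : 𝓛.systemContextProblem.Hard 𝒞) :
    (𝓛.withFactBase.QExists N).Hard 𝒞 ∧ (𝓛.withFactBase.QForall N).Hard (co 𝒞) := by
  have hlen : ((1 : ℕ) : ℕ∞) ≤ N := by simpa using h1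
  constructor
  · intro L hL
    obtain ⟨g, hg, hgx⟩ := exists_observer_of_hard h𝓛 hN h (.ofNat 1) hL
    refine ⟨g, hg, fun x => ?_⟩
    obtain ⟨k, kb, bel, act, R, P, hP, hs, e, hx⟩ := hgx x
    rw [e]
    exact ⟨⟨_, rfl, valid kind_factKind hs, hlen⟩, hx.trans
      ((enc_mem_QExists_yes (valid kind_factKind hs) hlen).trans
        (qExistsHolds_iff kind_factKind hP hs)).symm⟩
  · intro L hL
    -- By definition of `co`, `hL` says that the complement of `L` is in `𝒞`; it is this complement
    -- that is reduced, and the universal query negates the answer.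
    obtain ⟨g, hg, hgx⟩ := exists_observer_of_hard h𝓛 hN h (.ofNat 2) hL
    refine ⟨g, hg, fun x => ?_⟩
    obtain ⟨k, kb, bel, act, R, P, hP, hs, e, hx⟩ := hgx x
    rw [e]
    exact ⟨⟨_, rfl, valid kind_factKind hs, hlen⟩, (not_not.symm.trans (not_congr hx)).trans
      ((enc_mem_QForall_yes (valid kind_factKind hs) hlen).trans
        (qForallHolds_iff kind_factKind hP hs)).symm⟩

end Library
end TMCS

theorem mainTheorem2 (𝓛 : TMCS.Library) (h𝓛 : 𝓛.IsPolyTime) (N : ℕ∞)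
    (𝒞 : Set (Set TMCS.Data)) :
    -- membership
    (N ≠ ⊤ ∨ 𝓛.PolyGrowth → 𝓛.SystemContextComplexityIn 𝒞 →
      ((𝓛.QExists N).MemClass (TMCS.NPRel 𝒞) ∧
        (𝓛.QForall N).MemClass (TMCS.co (TMCS.NPRel 𝒞))) ∧
      (TMCS.NPConjClosed 𝒞 →
        (𝓛.QExists N).MemClass 𝒞 ∧ (𝓛.QForall N).MemClass (TMCS.co 𝒞))) ∧
    -- hardness
    (1 ≤ N → 𝓛.IsNeutral → 𝓛.systemContextProblem.Hard 𝒞 →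
      (𝓛.withFactBase.QExists N).Hard 𝒞 ∧
        (𝓛.withFactBase.QForall N).Hard (TMCS.co 𝒞)) :=
  ⟨fun hN h𝒞 =>
    ⟨TMCS.Library.membership h𝓛 hN h𝒞 fun m A hA _ hL => ⟨m, A, hA, hL.mem_npOracle⟩,
      fun hcl => TMCS.Library.membership h𝓛 hN h𝒞 hcl⟩,
    fun h1 hN h => TMCS.Library.hardness h𝓛 h1 hN h⟩
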